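/- By an ellipse we mean an open planar domain which, in suitable Cartesian coordinates, is $\{(x,y) : x^2/a^2+y^2/b^2<1\}$ with semi-axes $a,b>0$ (so disks, the case $a=b$, are included). For such a domain $\Omega$ let $D(\Omega)$ denote its diameter, and let $0=\mu_1(\Omega)<\mu_2(\Omega)\le\mu_3(\Omega)\le\dots$ denote the eigenvalues of the Neumann Laplacian on $\Omega$, listed in increasing order and repeated according to multiplicity; here $\mu\in\mathbb{R}$ is an eigenvalue if there is a nonzero $u\in H^1(\Omega)$ with $\int_\Omega\nabla u\cdot\nabla v\,dx=\mu\int_\Omega uv\,dx$ for all $v\in H^1(\Omega)$, which is the weak form of $-\Delta u=\mu u$ in $\Omega$ with $\partial u/\partial n=0$ on $\partial\Omega$. Among ellipses of given diameter, the disk strictly minimizes each Neumann eigenvalue with index $j\ge2$. That is, for every $j\ge 2$, every ellipse $E$ and every disk $B$, the $j$-th eigenvalues $\mu_j(E)$ and $\mu_j(B)$ exist and $$\mu_j(E)\,D(E)^2\;\ge\;\mu_j(B)\,D(B)^2,$$ with equality if and only if $E$ is a disk. -/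

import Mathlib

open MeasureTheory
open scoped ContDiff

/-- The Euclidean plane. -/
abbrev Plane : Type := EuclideanSpace ℝ (Fin 2)

/-- An open elliptical domain: in Cartesian coordinates with respect to some centre `c` and some
orthonormal basis `e` it is `{(x, y) : x² / a² + y² / b² < 1}`, with semi-axes `a, b > 0`. -/
def IsEllipse (E : Set Plane) : Prop :=
  ∃ (c : Plane) (e : OrthonormalBasis (Fin 2) ℝ Plane) (a b : ℝ), 0 < a ∧ 0 < b ∧
    E = {p : Plane | (inner ℝ (e 0) (p - c) / a) ^ 2 + (inner ℝ (e 1) (p - c) / b) ^ 2 < 1}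

/-- An open disk of positive radius. -/
def IsDisk (B : Set Plane) : Prop :=
  ∃ (c : Plane) (r : ℝ), 0 < r ∧ B = Metric.ball c r

/-- The real Hilbert space `L²(Ω)`. -/
abbrev L2Scalar (Ω : Set Plane) : Type := Lp ℝ 2 (volume.restrict Ω)

/-- The real Hilbert space `L²(Ω; ℝ²)` of square-integrable vector fields. -/
abbrev L2Field (Ω : Set Plane) : Type := Lp Plane 2 (volume.restrict Ω)

/-- `G ∈ L²(Ω; ℝ²)` is the weak (distributional) gradient of `u ∈ L²(Ω)` on `Ω`:
`∫_Ω u ∂_w φ = - ∫_Ω (G · w) φ` for all test functions `φ ∈ C_c^∞(Ω)` and all directions `w`.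
For open `Ω`, the Sobolev space `H¹(Ω)` consists of the `u` that have such a `G`. -/
def IsWeakGradient (Ω : Set Plane) (u : L2Scalar Ω) (G : L2Field Ω) : Prop :=
  ∀ φ : Plane → ℝ, ContDiff ℝ ∞ φ → HasCompactSupport φ → tsupport φ ⊆ Ω →
    ∀ w : Plane,
      ∫ x in Ω, u x * fderiv ℝ φ x w = - ∫ x in Ω, inner ℝ (G x) w * φ x

/-- `u` is an eigenfunction of the Neumann Laplacian on `Ω` with eigenvalue `κ`, that is, a
nonzero `u ∈ H¹(Ω)` solving `-Δu = κu` with the natural boundary condition `∂u/∂n = 0` in the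
weak sense: `∫_Ω ∇u · ∇v = κ ∫_Ω u v` for every `v ∈ H¹(Ω)`.  (The two `inner` are those of
`L²(Ω; ℝ²)` and `L²(Ω)`.) -/
def IsNeumannEigenfunction (Ω : Set Plane) (κ : ℝ) (u : L2Scalar Ω) : Prop :=
  u ≠ 0 ∧ ∃ G : L2Field Ω, IsWeakGradient Ω u G ∧
    ∀ (v : L2Scalar Ω) (H : L2Field Ω), IsWeakGradient Ω v H →
      inner ℝ G H = κ * inner ℝ u v

/-- The set of real `t` such that, counted with multiplicity, at least `j` Neumann eigenvalues of
`Ω` are at most `t`: there are `j` linearly independent eigenfunctions whose eigenvalues are at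
most `t`. -/
def neumannLevels (Ω : Set Plane) (j : ℕ) : Set ℝ :=
  {t : ℝ | ∃ u : Fin j → L2Scalar Ω, LinearIndependent ℝ u ∧
    ∀ i, ∃ κ : ℝ, κ ≤ t ∧ IsNeumannEigenfunction Ω κ (u i)}

/-- The `j`-th Neumann eigenvalue `μ_j(Ω)` in increasing order, counted with multiplicity and
starting from `μ_1`.  It is a genuine `j`-th eigenvalue when the infimum is attained. -/
noncomputable def neumannEigenvalue (Ω : Set Plane) (j : ℕ) : ℝ :=
  sInf (neumannLevels Ω j)

/-! Take semi-axes `a ≥ b`, so that the diameter is `2a`. The affine map from the unit disk onto the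
ellipse turns the Rayleigh quotient, multiplied by `a²`, into `∫ |S∇u|² / ∫ u²` on the unit disk,
where `S = diag (1, τ)` and `τ = a / b ≥ 1`; the Jacobian cancels (`neumannLevels_ellipse`). Hence
`μ_j D²` is four times the `j`-th eigenvalue of this form, and the disk is the case `τ = 1`. Since
`|∇u| ≤ |S∇u|`, the min-max principle gives the inequality (`sInf_diskLevels_one_le`).

Suppose equality holds for some `τ > 1`, with common value `t`. The span of `j` eigenfunctions of
the `τ`-form with eigenvalues at most `t` is a test space for `τ = 1` whose quotients are at most
the minimal level `t`, so it contains an eigenfunction `u` of the disk for `t`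
(`exists_eigen_of_forall_le`). Both energies of `u` agree, which forces `∂u/∂y = 0`. Since `j ≥ 2`,
`t > 0`, and a disk eigenfunction of nonzero eigenvalue with `∂u/∂y = 0` must vanish
(`eq_zero_of_eigen_of_snd_eq_zero`). Heuristically `u = f(x)`, and the Neumann condition reads `x
f'(x) = 0`; the proof replaces boundary values by polynomial moments of `u`.

Existence of the eigenvalues needs compactness of `H¹` in `L²`. It comes from an explicit Poincaré
inequality on functions orthogonal to polynomials of degree at most `N`, with constant `(N + 1)(N +
3)` (`poincare_unitDisk`). The operator `L p = div ((I - x xᵀ)∇p)` has the orthogonal polynomials of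
the disk as eigenfunctions, and its field is tangent to the circle, so integrating it by parts
against any `H¹` function leaves no boundary term and requires no traces. -/

/-! ### Abstract spectral theory: compactness, spectral gaps and min-max. -/

section RayleighForms

variable {V H F : Type*}
  [NormedAddCommGroup V] [InnerProductSpace ℝ V]
  [NormedAddCommGroup H] [InnerProductSpace ℝ H]
  [NormedAddCommGroup F] [InnerProductSpace ℝ F]

/-- For each `C`, the Rayleigh quotient `‖B w‖² / ‖P w‖²` is at least `C` on a subspace of finite
codimension. -/
def HasDivergentRayleigh (P : V →L[ℝ] H) (B : V →L[ℝ] F) : Prop :=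
  ∀ C : ℝ, ∃ X : Submodule ℝ H, FiniteDimensional ℝ X ∧
    ∀ w : V, P w ∈ Xᗮ → C * ‖P w‖ ^ 2 ≤ ‖B w‖ ^ 2

/-- The inner product of `V` is the graph inner product of `P` and `B`. -/
def IsGraphInner (P : V →L[ℝ] H) (B : V →L[ℝ] F) : Prop :=
  ∀ w z : V, inner ℝ w z = inner ℝ (P w) (P z) + inner ℝ (B w) (B z)

/-- `u = P w` is an eigenvector, with eigenvalue `κ`, of the form `⟪B ·, B ·⟫` relative to
`⟪P ·, P ·⟫`. -/
def IsFormEigenvector (P : V →L[ℝ] H) (B : V →L[ℝ] F) (κ : ℝ) (u : H) : Prop :=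
  u ≠ 0 ∧ ∃ w : V, P w = u ∧ ∀ z : V, inner ℝ (B w) (B z) = κ * inner ℝ (P w) (P z)

/-- The set of `t` such that at least `j` eigenvalues are at most `t`. -/
def formLevels (P : V →L[ℝ] H) (B : V →L[ℝ] F) (j : ℕ) : Set ℝ :=
  {t : ℝ | ∃ u : Fin j → H, LinearIndependent ℝ u ∧
    ∀ i, ∃ κ : ℝ, κ ≤ t ∧ IsFormEigenvector P B κ (u i)}

/-- The span of the eigenvectors with eigenvalue in `I`. -/
def eigenSpan (P : V →L[ℝ] H) (B : V →L[ℝ] F) (I : Set ℝ) : Submodule ℝ H :=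
  Submodule.span ℝ {u | ∃ κ ∈ I, IsFormEigenvector P B κ u}

variable {P : V →L[ℝ] H} {B : V →L[ℝ] F}

theorem IsGraphInner.norm_sq (hg : IsGraphInner P B) (w : V) :
    ‖w‖ ^ 2 = ‖P w‖ ^ 2 + ‖B w‖ ^ 2 := by
  have := hg w w
  simpa only [real_inner_self_eq_norm_sq] using this

theorem eigenSpan_mono {I J : Set ℝ} (h : I ⊆ J) : eigenSpan P B I ≤ eigenSpan P B J :=
  Submodule.span_mono fun _ ⟨κ, hκ, hu⟩ => ⟨κ, h hκ, hu⟩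

/-- The eigenvalue equation makes `P`-orthogonality to an eigenvector imply `B`-orthogonality to its
lift, and this passes to linear combinations. -/
theorem exists_lift_of_mem_eigenSpan {I : Set ℝ} {x : H} (hx : x ∈ eigenSpan P B I) :
    ∃ z : V, P z = x ∧
      ∀ w : V, P w ∈ (eigenSpan P B I)ᗮ → inner ℝ (B z) (B w) = 0 := by
  induction hx using Submodule.span_induction with
  | mem x h =>
    obtain ⟨κ, hκ, hx⟩ := h
    obtain ⟨-, z, hz, he⟩ := id hx
    refine ⟨z, hz, fun w hw => ?_⟩
    rw [he, hz, hw x (Submodule.subset_span ⟨κ, hκ, hx⟩), mul_zero]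
  | zero => exact ⟨0, map_zero _, fun w _ => by simp⟩
  | add x y _ _ hx hy =>
    obtain ⟨z, hz, h⟩ := hx
    obtain ⟨z', hz', h'⟩ := hy
    exact ⟨z + z', by rw [map_add, hz, hz'], fun w hw => by
      rw [map_add, inner_add_left, h w hw, h' w hw, add_zero]⟩
  | smul c x _ hx =>
    obtain ⟨z, hz, h⟩ := hx
    exact ⟨c • z, by rw [map_smul, hz], fun w hw => by
      rw [map_smul, real_inner_smul_left, h w hw, mul_zero]⟩

/-- A solution of the eigenvalue equation on the orthogonal complement of a span of eigenvectors
solves it everywhere. -/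
theorem eigen_equation_of_orthogonal {I : Set ℝ} [FiniteDimensional ℝ (eigenSpan P B I)]
    {κ : ℝ} {w : V} (hw : P w ∈ (eigenSpan P B I)ᗮ)
    (h : ∀ z : V, P z ∈ (eigenSpan P B I)ᗮ → inner ℝ (B w) (B z) = κ * inner ℝ (P w) (P z))
    (z : V) : inner ℝ (B w) (B z) = κ * inner ℝ (P w) (P z) := by
  -- Subtracting a lift of the projection of `P z` moves `z` into the complement; neither side of
  -- the equation sees the subtracted part.
  obtain ⟨x, hx, hx'⟩ := exists_lift_of_mem_eigenSpan
    ((eigenSpan P B I).starProjection_apply_mem (P z))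
  have h1 : P (z - x) ∈ (eigenSpan P B I)ᗮ := by
    rw [map_sub, hx]
    exact Submodule.sub_starProjection_mem_orthogonal _
  have h2 := h _ h1
  have h3 : inner ℝ (P w) (P x) = 0 := by
    rw [hx]
    exact Submodule.inner_left_of_mem_orthogonal (Submodule.starProjection_apply_mem _ _) hw
  rwa [map_sub, map_sub, inner_sub_right, inner_sub_right, h3,
    real_inner_comm (B x) (B w), hx' w hw, sub_zero, sub_zero] at h2

theorem IsFormEigenvector.inner_eq {κ κ' : ℝ} {w w' : V}
    (hw : ∀ z, inner ℝ (B w) (B z) = κ * inner ℝ (P w) (P z))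
    (hw' : ∀ z, inner ℝ (B w') (B z) = κ' * inner ℝ (P w') (P z)) :
    κ = κ' ∨ inner ℝ (P w) (P w') = 0 := by
  have h1 := hw w'
  have h2 := hw' w
  rw [real_inner_comm, h2, real_inner_comm] at h1
  by_cases h : κ = κ'
  · exact Or.inl h
  · refine Or.inr (by_contra fun h' => h (mul_right_cancel₀ h' h1).symm)

/-- Cross terms between distinct eigenvalues vanish, so `t‖Pv‖² - ‖Bv‖²` is the squared norm of the
combination with weights `√(t - κᵢ) cᵢ`. The eigenvectors need not be orthogonalized first. -/
theorem norm_sq_sum_le_of_eigen {ι : Type*} (s : Finset ι) {t : ℝ} (κ : ι → ℝ) (w : ι → V)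
    (hκ : ∀ i, κ i ≤ t) (hw : ∀ i z, inner ℝ (B (w i)) (B z) = κ i * inner ℝ (P (w i)) (P z))
    (c : ι → ℝ) :
    ‖B (∑ i ∈ s, c i • w i)‖ ^ 2 ≤ t * ‖P (∑ i ∈ s, c i • w i)‖ ^ 2 := by
  have key : t * ‖P (∑ i ∈ s, c i • w i)‖ ^ 2 - ‖B (∑ i ∈ s, c i • w i)‖ ^ 2
      = ‖P (∑ i ∈ s, (√(t - κ i) * c i) • w i)‖ ^ 2 := by
    simp only [← real_inner_self_eq_norm_sq, map_sum, map_smul, sum_inner, inner_sum,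
      real_inner_smul_left, real_inner_smul_right, Finset.mul_sum, ← Finset.sum_sub_distrib, hw]
    refine Finset.sum_congr rfl fun i _ => Finset.sum_congr rfl fun k _ => ?_
    rcases IsFormEigenvector.inner_eq (hw k) (hw i) with h | h
    · have := Real.mul_self_sqrt (sub_nonneg.2 (hκ i))
      rw [h]
      linear_combination (-c k * c i * inner ℝ (P (w k)) (P (w i))) * this
    · rw [h]; ring
  have := sq_nonneg ‖P (∑ i ∈ s, (√(t - κ i) * c i) • w i)‖
  linarith

theorem exists_lift_norm_sq_le {t : ℝ} {u : H} (hu : u ∈ eigenSpan P B (Set.Iic t)) :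
    ∃ w : V, P w = u ∧ ‖B w‖ ^ 2 ≤ t * ‖u‖ ^ 2 := by
  obtain ⟨n, f, g, rfl⟩ := Submodule.mem_span_set'.1 hu
  choose κ hκ hg using fun i => (g i).2
  choose h0 w hw he using hg
  refine ⟨∑ i, f i • w i, by simp [hw], ?_⟩
  have := norm_sq_sum_le_of_eigen Finset.univ κ w hκ he f
  simpa [hw] using this

/-- On the span the quotient is at most `t`, on `Xᗮ` at least `t + 1`; hence projection onto the
finite-dimensional `X` is injective on the span. -/
theorem finiteDimensional_eigenSpan (hC : HasDivergentRayleigh P B) {I : Set ℝ} {t : ℝ}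
    (hI : I ⊆ Set.Iic t) : FiniteDimensional ℝ (eigenSpan P B I) := by
  obtain ⟨X, hX, hb⟩ := hC (t + 1)
  let f : eigenSpan P B I →ₗ[ℝ] X :=
    (X.orthogonalProjectionOnto : H →ₗ[ℝ] X) ∘ₗ (eigenSpan P B I).subtype
  refine FiniteDimensional.of_injective f ?_
  rw [← LinearMap.ker_eq_bot, LinearMap.ker_eq_bot']
  rintro ⟨u, hu⟩ h0
  have hu' : u ∈ Xᗮ := Submodule.orthogonalProjectionOnto_eq_zero_iff.1 h0
  obtain ⟨w, rfl, hw⟩ := exists_lift_norm_sq_le (eigenSpan_mono hI hu)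
  have h1 := hb w hu'
  have h2 : ‖P w‖ ^ 2 ≤ 0 := by linarith
  have h3 : P w = 0 := by simpa using le_antisymm h2 (sq_nonneg _)
  exact Subtype.ext h3

theorem exists_eigenvectors_of_le_finrank {I : Set ℝ}
    [FiniteDimensional ℝ (eigenSpan P B I)] {j : ℕ}
    (hj : j ≤ Module.finrank ℝ (eigenSpan P B I)) :
    ∃ u : Fin j → H, LinearIndependent ℝ u ∧ ∀ i, ∃ κ ∈ I, IsFormEigenvector P B κ (u i) := by
  have : FiniteDimensional ℝ (Submodule.span ℝ {u | ∃ κ ∈ I, IsFormEigenvector P B κ u}) := ‹_›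
  obtain ⟨f, hf, -, hli⟩ := Submodule.exists_fun_fin_finrank_span_eq ℝ
    {u | ∃ κ ∈ I, IsFormEigenvector P B κ u}
  exact ⟨f ∘ Fin.castLE hj, hli.comp _ (Fin.castLE_injective hj), fun i => hf _⟩

theorem le_finrank_of_linearIndependent {I : Set ℝ} [FiniteDimensional ℝ (eigenSpan P B I)]
    {j : ℕ} {u : Fin j → H} (hu : LinearIndependent ℝ u)
    (h : ∀ i, ∃ κ ∈ I, IsFormEigenvector P B κ (u i)) :
    j ≤ Module.finrank ℝ (eigenSpan P B I) := by
  have h1 : Submodule.span ℝ (Set.range u) ≤ eigenSpan P B I :=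
    Submodule.span_le.2 (Set.range_subset_iff.2 fun i => Submodule.subset_span (h i))
  have h2 := Submodule.finrank_mono h1
  rwa [finrank_span_eq_card hu, Fintype.card_fin] at h2

/-- Turns levels into a counting function, so that min-max becomes a comparison of dimensions. -/
theorem mem_formLevels_iff (hC : HasDivergentRayleigh P B) {j : ℕ} {t : ℝ} :
    t ∈ formLevels P B j ↔ j ≤ Module.finrank ℝ (eigenSpan P B (Set.Iic t)) := by
  have := finiteDimensional_eigenSpan hC (subset_refl (Set.Iic t))
  refine ⟨fun ⟨u, hu, h⟩ => le_finrank_of_linearIndependent hu h,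
    fun h => exists_eigenvectors_of_le_finrank (I := Set.Iic t) h⟩

theorem exists_combination_mem_orthogonal {j : ℕ} (u : Fin j → H) (X : Submodule ℝ H)
    [FiniteDimensional ℝ X] (hX : Module.finrank ℝ X < j) :
    ∃ c : Fin j → ℝ, c ≠ 0 ∧ ∑ i, c i • u i ∈ Xᗮ := by
  let f : (Fin j → ℝ) →ₗ[ℝ] X :=
    (X.orthogonalProjectionOnto : H →ₗ[ℝ] X) ∘ₗ Fintype.linearCombination ℝ u
  have hf : f.ker ≠ ⊥ := LinearMap.ker_ne_bot_of_finrank_lt (by simpa using hX)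
  obtain ⟨c, hc, hc0⟩ := Submodule.exists_mem_ne_zero_of_ne_bot hf
  refine ⟨c, hc0, ?_⟩
  have : X.orthogonalProjectionOnto (∑ i, c i • u i) = 0 := by
    simpa [f, Fintype.linearCombination_apply] using hc
  exact Submodule.orthogonalProjectionOnto_eq_zero_iff.1 this

variable [CompleteSpace V] [CompleteSpace H]

/-- `P` is a norm limit of finite-rank operators: on `K n`, the preimage of `(X n)ᗮ`, the graph norm
dominates `√(n + 1) ‖P w‖`, and `K n` has finite codimension because its complement injects into `X
n`. -/
theorem isCompactOperator_of_hasDivergentRayleigh (hg : IsGraphInner P B)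
    (hC : HasDivergentRayleigh P B) : IsCompactOperator P := by
  choose X hX hXb using fun n : ℕ => hC ((n : ℝ) + 1)
  let K : ℕ → Submodule ℝ V := fun n => (X n)ᗮ.comap (P : V →ₗ[ℝ] H)
  have hKc : ∀ n, IsClosed (K n : Set V) := fun n =>
    (Submodule.isClosed_orthogonal (X n)).preimage P.continuous
  have : ∀ n, CompleteSpace (K n) := fun n => (hKc n).completeSpace_coe
  have hfd : ∀ n, FiniteDimensional ℝ (K n)ᗮ := fun n => by
    have := hX n
    let f : (K n)ᗮ →ₗ[ℝ] X n :=
      (((X n).orthogonalProjectionOnto ∘L P : V →L[ℝ] X n) : V →ₗ[ℝ] X n) ∘ₗ (K n)ᗮ.subtype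
    refine FiniteDimensional.of_injective f ?_
    rw [← LinearMap.ker_eq_bot, LinearMap.ker_eq_bot']
    intro w hw
    have h1 : (w : V) ∈ K n := by
      change P w ∈ (X n)ᗮ
      exact Submodule.orthogonalProjectionOnto_eq_zero_iff.1 hw
    have h2 : (w : V) ∈ (K n) ⊓ (K n)ᗮ := ⟨h1, w.2⟩
    rw [Submodule.inf_orthogonal_eq_bot] at h2
    exact Subtype.ext ((Submodule.mem_bot ℝ).1 h2)
  have hcomp : ∀ n, IsCompactOperator (P ∘L (K n)ᗮ.starProjection) := fun n => by
    have := hfd n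
    have : IsCompactOperator (P ∘L (K n)ᗮ.subtypeL) :=
      isCompactOperator_of_locallyCompactSpace_rng _
    exact this.comp_clm ((K n)ᗮ.orthogonalProjectionOnto)
  have hbound : ∀ n, ‖P ∘L (K n)ᗮ.starProjection - P‖ ≤ 1 / √((n : ℝ) + 1) := fun n => by
    refine ContinuousLinearMap.opNorm_le_bound _ (by positivity) fun w => ?_
    have e : (P ∘L (K n)ᗮ.starProjection - P) w = - P ((K n).starProjection w) := by
      have := congrArg P ((K n).starProjection_add_starProjection_orthogonal w)
      rw [map_add] at this
      simp only [sub_apply, ContinuousLinearMap.comp_apply]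
      rw [← this]; abel
    have hm : (K n).starProjection w ∈ K n := Submodule.starProjection_apply_mem _ _
    have h1 := hXb n _ hm
    have h2 := hg.norm_sq ((K n).starProjection w)
    have h3 : ‖(K n).starProjection w‖ ≤ ‖w‖ := by
      simpa using ContinuousLinearMap.le_of_opNorm_le _ ((K n).starProjection_norm_le) w
    rw [e, norm_neg, one_div, inv_mul_eq_div, le_div_iff₀ (by positivity)]
    refine le_of_sq_le_sq ?_ (norm_nonneg _)
    rw [mul_pow, Real.sq_sqrt (by positivity)]
    nlinarith [norm_nonneg ((K n).starProjection w), sq_nonneg ‖P ((K n).starProjection w)‖]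
  refine isCompactOperator_of_tendsto (l := Filter.atTop)
    (F := fun n => P ∘L (K n)ᗮ.starProjection) ?_ (Filter.Eventually.of_forall hcomp)
  rw [tendsto_iff_norm_sub_tendsto_zero]
  refine squeeze_zero (fun _ => norm_nonneg _) hbound ?_
  have : Filter.Tendsto (fun n : ℕ => √((n : ℝ) + 1)) Filter.atTop Filter.atTop :=
    Real.tendsto_sqrt_atTop.comp (Filter.tendsto_atTop_add_const_right _ _ tendsto_natCast_atTop_atTop)
  simp only [one_div]
  exact this.inv_tendsto_atTop

/-- A nonzero compact operator attains its norm at a singular vector. -/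
theorem exists_singular_vector {K : Type*} [NormedAddCommGroup K] [InnerProductSpace ℝ K]
    [CompleteSpace K] (Q : K →L[ℝ] H) (hQ : IsCompactOperator Q) (h0 : Q ≠ 0) :
    ∃ l : ℝ, 0 < l ∧ (∀ z, ‖Q z‖ ^ 2 ≤ l * ‖z‖ ^ 2) ∧
      ∃ w : K, Q w ≠ 0 ∧ ∀ z : K, inner ℝ (Q w) (Q z) = l * inner ℝ w z := by
  set T : K →L[ℝ] K := ContinuousLinearMap.adjoint Q ∘L Q with hT
  have hTc : IsCompactOperator T := hQ.clm_comp (ContinuousLinearMap.adjoint Q)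
  have hTi : ∀ w z, inner ℝ (T w) z = inner ℝ (Q w) (Q z) := fun w z => by
    simp [hT, ContinuousLinearMap.adjoint_inner_left]
  have hTs : (T : K →ₗ[ℝ] K).IsSymmetric := fun w z => by
    change inner ℝ (T w) z = inner ℝ w (T z)
    rw [hTi, real_inner_comm, ← hTi, real_inner_comm]
  have hT0 : T ≠ 0 := by
    intro h
    apply h0
    ext w
    have := hTi w w
    rw [h] at this
    simpa using this.symm
  have := (ContinuousLinearMap.eq_zero_of_forall_hasEigenvalue_eq_zero hTc hTs).not.2 hT0
  push Not at this
  obtain ⟨l', hl', hl0'⟩ := this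
  -- For the self-adjoint `T` the spectral radius is `‖T‖`, so some spectral value has modulus
  -- `‖T‖`. It is nonzero, hence an eigenvalue by compactness, and positivity of `Q* Q` later fixes
  -- its sign.
  obtain ⟨l, hl, hlT⟩ := spectrum.exists_nnnorm_eq_spectralRadius_of_nonempty
    ⟨l', (hTc.hasEigenvalue_iff_mem_spectrum hl0').1 hl'⟩
  rw [T.spectralRadius_eq_nnnorm hTs.isSelfAdjoint, ENNReal.coe_inj] at hlT
  replace hlT : |l| = ‖T‖ := by simpa using congrArg NNReal.toReal hlT
  have hl0 : l ≠ 0 := by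
    rw [← abs_pos, hlT]
    exact norm_pos_iff.2 hT0
  replace hl := (hTc.hasEigenvalue_iff_mem_spectrum hl0).2 hl
  obtain ⟨w, hw⟩ := hl.exists_hasEigenvector
  have hw1 : T w = l • w := hw.apply_eq_smul
  have hw0 : w ≠ 0 := hw.2
  have key : ∀ z, inner ℝ (Q w) (Q z) = l * inner ℝ w z := fun z => by
    rw [← hTi, hw1, real_inner_smul_left]
  have hn : 0 < ‖w‖ ^ 2 := by positivity
  have hQw : Q w ≠ 0 := by
    intro h
    have := key w
    rw [h, inner_zero_left, real_inner_self_eq_norm_sq] at this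
    rcases mul_eq_zero.1 this.symm with h | h
    · exact hl0 h
    · exact hn.ne' h
  suffices hlp : 0 < l by
    refine ⟨l, hlp, fun z => ?_, w, hQw, key⟩
    rw [abs_of_pos hlp] at hlT
    rw [← real_inner_self_eq_norm_sq, ← hTi, hlT]
    calc inner ℝ (T z) z ≤ ‖T z‖ * ‖z‖ := real_inner_le_norm _ _
      _ ≤ ‖T‖ * ‖z‖ * ‖z‖ := by gcongr; exact T.le_opNorm z
      _ = _ := by ring
  have h1 := key w
  rw [real_inner_self_eq_norm_sq, real_inner_self_eq_norm_sq] at h1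
  have : 0 < ‖Q w‖ ^ 2 := by positivity
  by_contra hneg
  nlinarith

/-- Above level `t` there is a spectral gap. -/
theorem exists_gap (hg : IsGraphInner P B) (hC : HasDivergentRayleigh P B) (t : ℝ) :
    ∃ k > t, ∀ w, P w ∈ (eigenSpan P B (Set.Iic t))ᗮ → k * ‖P w‖ ^ 2 ≤ ‖B w‖ ^ 2 := by
  have := finiteDimensional_eigenSpan hC (subset_refl (Set.Iic t))
  let K : Submodule ℝ V := (eigenSpan P B (Set.Iic t))ᗮ.comap (P : V →ₗ[ℝ] H)
  have hKc : IsClosed (K : Set V) := (Submodule.isClosed_orthogonal _).preimage P.continuous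
  have : CompleteSpace K := hKc.completeSpace_coe
  have hQ : IsCompactOperator (P ∘L K.subtypeL) :=
    (isCompactOperator_of_hasDivergentRayleigh hg hC).comp_clm K.subtypeL
  by_cases h0 : P ∘L K.subtypeL = 0
  · refine ⟨t + 1, by linarith, fun w hw => ?_⟩
    have : P w = 0 := DFunLike.congr_fun h0 ⟨w, hw⟩
    simp [this]
  obtain ⟨l, hl, hmax, w, hw0, hw⟩ := exists_singular_vector _ hQ h0
  -- Solve `⟪Pw, Pz⟫ = l (⟪Pw, Pz⟫ + ⟪Bw, Bz⟫)` for the `B` term. If this eigenvalue were at most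
  -- `t`, then `P w` would lie in the span and be orthogonal to itself.
  have he : IsFormEigenvector P B (1 / l - 1) (P w) := by
    refine ⟨hw0, w, rfl, eigen_equation_of_orthogonal (I := Set.Iic t) w.2 fun z hz => ?_⟩
    have h1 := hw ⟨z, hz⟩
    have h2 := hg w z
    simp only [ContinuousLinearMap.comp_apply, Submodule.subtypeL_apply, Submodule.coe_inner]
      at h1
    rw [h2] at h1
    field_simp
    linarith
  refine ⟨1 / l - 1, ?_, fun z hz => ?_⟩
  · by_contra! hle
    have h1 : P w ∈ eigenSpan P B (Set.Iic t) := Submodule.subset_span ⟨_, hle, he⟩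
    exact hw0 (inner_self_eq_zero.1 (w.2 _ h1))
  · have h1 := hmax ⟨z, hz⟩
    have h2 := hg.norm_sq z
    simp only [ContinuousLinearMap.comp_apply, Submodule.subtypeL_apply, Submodule.coe_norm] at h1
    rw [h2] at h1
    field_simp
    linarith

/-- The testing half of min-max. With fewer than `j` eigenvalues up to `t`, a nonzero test vector is
orthogonal to their span, and the gap makes its quotient exceed `t`. No expansion in eigenfunctions
is needed. -/
theorem mem_formLevels_of_forall_le (hg : IsGraphInner P B) (hC : HasDivergentRayleigh P B)
    {j : ℕ} {t : ℝ} (w : Fin j → V) (hw : LinearIndependent ℝ (fun i => P (w i)))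
    (hb : ∀ c : Fin j → ℝ, ‖B (∑ i, c i • w i)‖ ^ 2 ≤ t * ‖P (∑ i, c i • w i)‖ ^ 2) :
    t ∈ formLevels P B j := by
  have := finiteDimensional_eigenSpan hC (subset_refl (Set.Iic t))
  rw [mem_formLevels_iff hC]
  by_contra! hlt
  obtain ⟨c, hc, hperp⟩ := exists_combination_mem_orthogonal (fun i => P (w i)) _ hlt
  obtain ⟨k, hk, hgap⟩ := exists_gap hg hC t
  have e : P (∑ i, c i • w i) = ∑ i, c i • P (w i) := by simp
  have h1 := hgap (∑ i, c i • w i) (by rwa [e])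
  have h2 := hb c
  have h3 : P (∑ i, c i • w i) ≠ 0 := fun h => hc <| by
    rw [e] at h
    exact funext (Fintype.linearIndependent_iff.1 hw c h)
  have : 0 < ‖P (∑ i, c i • w i)‖ ^ 2 := by positivity
  nlinarith

theorem isLeast_formLevels (hg : IsGraphInner P B) (hC : HasDivergentRayleigh P B) {j : ℕ}
    (hj : 1 ≤ j) (hd : ∃ w : Fin j → V, LinearIndependent ℝ (fun i => P (w i))) :
    IsLeast (formLevels P B j) (sInf (formLevels P B j)) := by
  have hne : (formLevels P B j).Nonempty := by
    obtain ⟨w, hw⟩ := hd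
    let f : (Fin j → ℝ) →ₗ[ℝ] V := Fintype.linearCombination ℝ w
    have hf : ((P : V →ₗ[ℝ] H) ∘ₗ f).ker = ⊥ := by
      rw [LinearMap.ker_eq_bot']
      intro c hc
      refine funext (Fintype.linearIndependent_iff.1 hw c ?_)
      simpa [f, Fintype.linearCombination_apply] using hc
    obtain ⟨K, -, hK⟩ := LinearMap.exists_antilipschitzWith _ hf
    let g : (Fin j → ℝ) →L[ℝ] F := LinearMap.toContinuousLinearMap ((B : V →ₗ[ℝ] F) ∘ₗ f)
    refine ⟨(‖g‖ * K) ^ 2, mem_formLevels_of_forall_le hg hC w hw fun c => ?_⟩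
    have h1 : ‖c‖ ≤ K * ‖P (f c)‖ := by
      simpa using hK.le_mul_norm_sub c 0
    have h2 : ‖B (f c)‖ ≤ ‖g‖ * ‖c‖ := g.le_opNorm c
    have h3 : f c = ∑ i, c i • w i := Fintype.linearCombination_apply ..
    rw [← h3, ← mul_pow]
    gcongr
    calc _ ≤ ‖g‖ * ‖c‖ := h2
      _ ≤ ‖g‖ * (K * ‖P (f c)‖) := by gcongr
      _ = _ := by ring
  have hbdd : BddBelow (formLevels P B j) := by
    refine ⟨0, fun t ⟨u, hu, h⟩ => ?_⟩
    obtain ⟨κ, hκ, h0, w, hw, he⟩ := h ⟨0, hj⟩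
    have h1 := he w
    rw [real_inner_self_eq_norm_sq, real_inner_self_eq_norm_sq, hw] at h1
    have : 0 < ‖u ⟨0, hj⟩‖ ^ 2 := by positivity
    by_contra! hneg
    nlinarith [sq_nonneg ‖B w‖]
  refine ⟨?_, fun t ht => csInf_le hbdd ht⟩
  set t₀ := sInf (formLevels P B j)
  have := finiteDimensional_eigenSpan hC (subset_refl (Set.Iic t₀))
  rw [mem_formLevels_iff hC]
  by_contra! hlt
  -- Were the count at the infimum `t₀` below `j`, every level would be at least the gap value `k >
  -- t₀`.
  obtain ⟨k, hk, hgap⟩ := exists_gap hg hC t₀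
  refine absurd (le_csInf hne (a := k) fun t ht => ?_) (not_le.2 hk)
  obtain ⟨u, hu, h⟩ := ht
  choose κ hκ h0 w hw he using h
  obtain ⟨c, hc, hperp⟩ := exists_combination_mem_orthogonal u _ hlt
  have e : P (∑ i, c i • w i) = ∑ i, c i • u i := by simp [hw]
  have h1 := hgap (∑ i, c i • w i) (by rwa [e])
  have h2 := norm_sq_sum_le_of_eigen Finset.univ κ w hκ he c
  have h3 : P (∑ i, c i • w i) ≠ 0 := fun h => hc <| by
    rw [e] at h
    exact funext (Fintype.linearIndependent_iff.1 hu c h)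
  have : 0 < ‖P (∑ i, c i • w i)‖ ^ 2 := by positivity
  exact le_of_mul_le_mul_right (h1.trans h2) this

/-- If the Rayleigh quotient is at most the `j`-th eigenvalue `t` on a `j`-dimensional space, that
space contains an eigenvector for `t`. -/
theorem exists_eigen_of_forall_le (hg : IsGraphInner P B) (hC : HasDivergentRayleigh P B)
    {j : ℕ} (hj : 1 ≤ j) {t : ℝ} (ht : t ∈ lowerBounds (formLevels P B j))
    (w : Fin j → V) (hw : LinearIndependent ℝ (fun i => P (w i)))
    (hb : ∀ c : Fin j → ℝ, ‖B (∑ i, c i • w i)‖ ^ 2 ≤ t * ‖P (∑ i, c i • w i)‖ ^ 2) :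
    ∃ c : Fin j → ℝ, P (∑ i, c i • w i) ≠ 0 ∧
      ∀ z, inner ℝ (B (∑ i, c i • w i)) (B z) = t * inner ℝ (P (∑ i, c i • w i)) (P z) := by
  have hfd := finiteDimensional_eigenSpan hC (I := Set.Iio t) (t := t) Set.Iio_subset_Iic_self
  -- Otherwise the largest of `j` eigenvalues, all below `t`, would itself be a level below `t`.
  have hlt : Module.finrank ℝ (eigenSpan P B (Set.Iio t)) < j := by
    by_contra! hle
    obtain ⟨u, hu, h⟩ := exists_eigenvectors_of_le_finrank hle
    choose κ hκ he using h
    have : Nonempty (Fin j) := ⟨⟨0, hj⟩⟩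
    obtain ⟨i, hi⟩ := Finite.exists_max κ
    exact absurd (ht ⟨u, hu, fun k => ⟨κ k, hi k, he k⟩⟩) (not_le.2 (hκ i))
  have hpos : ∀ z, P z ∈ (eigenSpan P B (Set.Iio t))ᗮ → t * ‖P z‖ ^ 2 ≤ ‖B z‖ ^ 2 := by
    intro z hz
    by_contra! hlt'
    have hpz : 0 < ‖P z‖ ^ 2 := (sq_nonneg _).lt_of_ne fun h => by
      rw [← h, mul_zero] at hlt'
      exact (sq_nonneg ‖B z‖).not_gt hlt'
    have hst : ‖B z‖ ^ 2 / ‖P z‖ ^ 2 < t := (div_lt_iff₀ hpz).2 hlt'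
    -- The gap is taken at the supposed quotient of `z` itself, which is below `t` and so
    -- contradicts it.
    obtain ⟨k, hk, hgap⟩ := exists_gap hg hC (‖B z‖ ^ 2 / ‖P z‖ ^ 2)
    have h1 := hgap z (Submodule.orthogonal_le (eigenSpan_mono fun s hs => hs.trans_lt hst) hz)
    rw [gt_iff_lt, div_lt_iff₀ hpz] at hk
    exact hk.not_ge h1
  obtain ⟨c, hc, hperp⟩ := exists_combination_mem_orthogonal (fun i => P (w i)) _ hlt
  have e : P (∑ i, c i • w i) = ∑ i, c i • P (w i) := by simp
  have h3 : P (∑ i, c i • w i) ≠ 0 := fun h => hc <| by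
    rw [e] at h
    exact funext (Fintype.linearIndependent_iff.1 hw c h)
  set y := ∑ i, c i • w i
  rw [← e] at hperp
  have h0 : ‖B y‖ ^ 2 = t * ‖P y‖ ^ 2 := le_antisymm (hb c) (hpos y hperp)
  refine ⟨c, h3, ?_⟩
  refine eigen_equation_of_orthogonal hperp fun z hz => ?_
  -- First variation: `y` minimizes `‖B ·‖² - t‖P ·‖²` on the complement with value zero, so this
  -- quadratic in `s` has no constant term and its linear coefficient must vanish.
  have hq : ∀ s : ℝ, 0 ≤ (‖B z‖ ^ 2 - t * ‖P z‖ ^ 2) * (s * s)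
      + (2 * (inner ℝ (B y) (B z) - t * inner ℝ (P y) (P z))) * s + 0 := by
    intro s
    have := hpos (y + s • z) (by
      rw [map_add, map_smul]
      exact Submodule.add_mem _ hperp (Submodule.smul_mem _ _ hz))
    simp only [map_add, map_smul, norm_add_sq_real, norm_smul, real_inner_smul_right, mul_pow,
      Real.norm_eq_abs, sq_abs] at this
    linarith
  have hd := discrim_le_zero hq
  rw [discrim] at hd
  have : inner ℝ (B y) (B z) - t * inner ℝ (P y) (P z) = 0 := by
    rw [← sq_eq_zero_iff]
    nlinarith [sq_nonneg (inner ℝ (B y) (B z) - t * inner ℝ (P y) (P z))]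
  linarith

end RayleighForms

/-! ### The Sobolev space as a closed graph. -/

section WeakGradients

theorem inner_toLp {Ω : Set Plane} {E : Type*} [NormedAddCommGroup E] [InnerProductSpace ℝ E]
    (u : Lp E 2 (volume.restrict Ω)) {f : Plane → E} (hf : MemLp f 2 (volume.restrict Ω)) :
    inner ℝ u (hf.toLp f) = ∫ x in Ω, inner ℝ (u x) (f x) := by
  rw [L2.inner_def]
  refine integral_congr_ae ?_
  filter_upwards [hf.coeFn_toLp] with x hx
  rw [hx]

/-- Testing the relation `IsWeakGradient` against `φ` and `w` is taking inner products. -/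
theorem exists_inner_eq_test (Ω : Set Plane) {φ : Plane → ℝ} (hφ : ContDiff ℝ ∞ φ)
    (hc : HasCompactSupport φ) (w : Plane) :
    ∃ (a : L2Scalar Ω) (b : L2Field Ω), ∀ (u : L2Scalar Ω) (G : L2Field Ω),
      (∫ x in Ω, u x * fderiv ℝ φ x w) = inner ℝ u a ∧
      (∫ x in Ω, inner ℝ (G x) w * φ x) = inner ℝ G b := by
  have h1 : MemLp (fun x => fderiv ℝ φ x w) 2 (volume.restrict Ω) :=
    ((hφ.continuous_fderiv (by simp)).clm_apply continuous_const).memLp_of_hasCompactSupport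
      (hc.fderiv_apply (𝕜 := ℝ) w)
  have h2 : MemLp (fun x => φ x • w) 2 (volume.restrict Ω) :=
    (hφ.continuous.smul continuous_const).memLp_of_hasCompactSupport hc.smul_right
  refine ⟨h1.toLp _, h2.toLp _, fun u G => ⟨?_, ?_⟩⟩
  · rw [inner_toLp]
    simp only [RCLike.inner_apply, conj_trivial, mul_comm]
  · rw [inner_toLp]
    simp only [real_inner_smul_right, mul_comm]

/-- The pairs `(u, G)` such that `G` is the weak gradient of `u` on `Ω`: the space `H¹(Ω)`. -/
def sobolevGraph (Ω : Set Plane) : Submodule ℝ (WithLp 2 (L2Scalar Ω × L2Field Ω)) where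
  carrier := {x | IsWeakGradient Ω x.fst x.snd}
  add_mem' := by
    intro x y hx hy φ hφ hc hs w
    obtain ⟨a, b, h⟩ := exists_inner_eq_test Ω hφ hc w
    have h1 := hx φ hφ hc hs w
    have h2 := hy φ hφ hc hs w
    rw [(h _ x.snd).1, (h x.fst _).2] at h1
    rw [(h _ y.snd).1, (h y.fst _).2] at h2
    rw [(h _ (x + y).snd).1, (h (x + y).fst _).2, WithLp.add_fst, WithLp.add_snd,
      inner_add_left, inner_add_left, h1, h2]
    ring
  zero_mem' := by
    intro φ hφ hc hs w
    obtain ⟨a, b, h⟩ := exists_inner_eq_test Ω hφ hc w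
    rw [(h _ 0).1, (h 0 _).2]
    simp
  smul_mem' := by
    intro c x hx φ hφ hc hs w
    obtain ⟨a, b, h⟩ := exists_inner_eq_test Ω hφ hc w
    have h1 := hx φ hφ hc hs w
    rw [(h _ x.snd).1, (h x.fst _).2] at h1
    rw [(h _ (c • x).snd).1, (h (c • x).fst _).2, WithLp.smul_fst, WithLp.smul_snd,
      real_inner_smul_left, real_inner_smul_left, h1]
    ring

theorem isClosed_sobolevGraph (Ω : Set Plane) : 
    IsClosed (sobolevGraph Ω : Set (WithLp 2 (L2Scalar Ω × L2Field Ω))) := by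
  have : (sobolevGraph Ω : Set (WithLp 2 (L2Scalar Ω × L2Field Ω))) =
      ⋂ (φ : Plane → ℝ) (_ : ContDiff ℝ ∞ φ) (_ : HasCompactSupport φ) (_ : tsupport φ ⊆ Ω)
        (w : Plane), {x | ∫ y in Ω, x.fst y * fderiv ℝ φ y w
          = - ∫ y in Ω, inner ℝ (x.snd y) w * φ y} := by
    ext x
    simp only [Set.mem_iInter]
    rfl
  rw [this]
  refine isClosed_iInter fun φ => isClosed_iInter fun hφ => isClosed_iInter fun hc =>
    isClosed_iInter fun _ => isClosed_iInter fun w => ?_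
  obtain ⟨a, b, h⟩ := exists_inner_eq_test Ω hφ hc w
  have e : {x : WithLp 2 (L2Scalar Ω × L2Field Ω) | ∫ y in Ω, x.fst y * fderiv ℝ φ y w
      = - ∫ y in Ω, inner ℝ (x.snd y) w * φ y} = {x | inner ℝ x.fst a = - inner ℝ x.snd b} := by
    ext x
    rw [Set.mem_ofPred_eq, (h _ x.snd).1, (h x.fst _).2]
    rfl
  rw [e]
  have c1 : Continuous fun x : WithLp 2 (L2Scalar Ω × L2Field Ω) => x.fst :=
    (WithLp.fstL 2 ℝ _ _).continuous
  have c2 : Continuous fun x : WithLp 2 (L2Scalar Ω × L2Field Ω) => x.snd :=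
    (WithLp.sndL 2 ℝ _ _).continuous
  exact isClosed_eq (c1.inner continuous_const) (c2.inner continuous_const).neg

end WeakGradients

/-! ### Polynomials on the unit disk and their density in `L²`. -/

section Polynomials

open MvPolynomial

/-- The open unit disk. -/
abbrev unitDisk : Set Plane := Metric.ball 0 1

/-- The function on the plane given by a polynomial. -/
noncomputable def polyFun (p : MvPolynomial (Fin 2) ℝ) (x : Plane) : ℝ := eval (fun i => x i) p

@[simp] theorem polyFun_add (p q : MvPolynomial (Fin 2) ℝ) (x : Plane) :
    polyFun (p + q) x = polyFun p x + polyFun q x := map_add _ _ _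

@[simp] theorem polyFun_sub (p q : MvPolynomial (Fin 2) ℝ) (x : Plane) :
    polyFun (p - q) x = polyFun p x - polyFun q x := map_sub _ _ _

@[simp] theorem polyFun_mul (p q : MvPolynomial (Fin 2) ℝ) (x : Plane) :
    polyFun (p * q) x = polyFun p x * polyFun q x := map_mul _ _ _

@[simp] theorem polyFun_smul (c : ℝ) (p : MvPolynomial (Fin 2) ℝ) (x : Plane) :
    polyFun (c • p) x = c * polyFun p x := smul_eval _ _ _

@[simp] theorem polyFun_X (i : Fin 2) (x : Plane) : polyFun (X i) x = x i := eval_X _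

@[simp] theorem polyFun_C (c : ℝ) (x : Plane) : polyFun (C c) x = c := eval_C _

@[simp] theorem polyFun_one (x : Plane) : polyFun 1 x = 1 := map_one _

@[simp] theorem polyFun_zero (x : Plane) : polyFun 0 x = 0 := map_zero _

@[simp] theorem polyFun_pow (p : MvPolynomial (Fin 2) ℝ) (n : ℕ) (x : Plane) :
    polyFun (p ^ n) x = polyFun p x ^ n := map_pow _ _ _

@[simp] theorem polyFun_neg (p : MvPolynomial (Fin 2) ℝ) (x : Plane) :
    polyFun (-p) x = -polyFun p x := map_neg _ _

theorem hasFDerivAt_polyFun (p : MvPolynomial (Fin 2) ℝ) (x : Plane) :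
    HasFDerivAt (polyFun p)
      (∑ i, polyFun (pderiv i p) x • (EuclideanSpace.proj i : Plane →L[ℝ] ℝ)) x := by
  induction p using MvPolynomial.induction_on with
  | C a =>
    have : polyFun (C a) = fun _ => a := by ext y; simp
    rw [this]
    simpa using hasFDerivAt_const a x
  | add p q hp hq =>
    have : polyFun (p + q) = fun y => polyFun p y + polyFun q y := by ext y; simp
    rw [this]
    refine (hp.add hq).congr_fderiv ?_
    simp [add_smul, Finset.sum_add_distrib]
  | mul_X p k hp =>
    have : polyFun (p * X k) = fun y => polyFun p y * y k := by ext y; simp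
    rw [this]
    refine (hp.mul ((EuclideanSpace.proj k : Plane →L[ℝ] ℝ).hasFDerivAt (x := x))).congr_fderiv ?_
    ext w
    fin_cases k <;> simp [Derivation.leibniz, pderiv_X, Pi.single_apply] <;> ring

theorem fderiv_polyFun (p : MvPolynomial (Fin 2) ℝ) (x w : Plane) :
    fderiv ℝ (polyFun p) x w = ∑ i, polyFun (pderiv i p) x * w i := by
  simp [(hasFDerivAt_polyFun p x).fderiv]

theorem contDiff_polyFun (p : MvPolynomial (Fin 2) ℝ) {n : WithTop ℕ∞} :
    ContDiff ℝ n (polyFun p) := by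
  induction p using MvPolynomial.induction_on with
  | C a =>
    have : polyFun (C a) = fun _ => a := by ext y; simp
    rw [this]
    exact contDiff_const
  | add p q hp hq =>
    have : polyFun (p + q) = fun y => polyFun p y + polyFun q y := by ext y; simp
    rw [this]
    exact hp.add hq
  | mul_X p k hp =>
    have : polyFun (p * X k) = fun y => polyFun p y * y k := by ext y; simp
    rw [this]
    exact hp.mul (EuclideanSpace.proj k : Plane →L[ℝ] ℝ).contDiff

theorem continuous_polyFun (p : MvPolynomial (Fin 2) ℝ) : Continuous (polyFun p) :=
  (contDiff_polyFun p (n := 0)).continuous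

instance : IsFiniteMeasure (volume.restrict unitDisk) :=
  ⟨by rw [Measure.restrict_apply_univ]; exact measure_ball_lt_top⟩

theorem memLp_of_continuous {E : Type*} [NormedAddCommGroup E] {f : Plane → E}
    (hf : Continuous f) : MemLp f 2 (volume.restrict unitDisk) := by
  obtain ⟨C, hC⟩ := (isCompact_closedBall (0 : Plane) 1).exists_bound_of_continuousOn
    hf.continuousOn
  refine MemLp.of_bound hf.aestronglyMeasurable C ?_
  filter_upwards [ae_restrict_mem measurableSet_ball] with x hx
  exact hC x (Metric.ball_subset_closedBall hx)

/-- A polynomial as an element of `L²` of the unit disk. -/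
noncomputable def polyL2 : MvPolynomial (Fin 2) ℝ →ₗ[ℝ] L2Scalar unitDisk where
  toFun p := (memLp_of_continuous (continuous_polyFun p)).toLp (polyFun p)
  map_add' p q := by
    rw [← MemLp.toLp_add]
    exact MemLp.toLp_congr _ _ (.of_forall fun x => polyFun_add p q x)
  map_smul' c p := by
    rw [RingHom.id_apply, ← MemLp.toLp_const_smul]
    exact MemLp.toLp_congr _ _ (.of_forall fun x => polyFun_smul c p x)

theorem coeFn_polyL2 (p : MvPolynomial (Fin 2) ℝ) :
    polyL2 p =ᵐ[volume.restrict unitDisk] polyFun p :=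
  MemLp.coeFn_toLp (memLp_of_continuous (continuous_polyFun p))

/-- The vector field with two polynomial coordinates. -/
noncomputable def polyVec (f : Fin 2 → MvPolynomial (Fin 2) ℝ) (x : Plane) : Plane :=
  WithLp.toLp 2 fun i => polyFun (f i) x

@[simp] theorem polyVec_apply (f : Fin 2 → MvPolynomial (Fin 2) ℝ) (x : Plane) (i : Fin 2) :
    polyVec f x i = polyFun (f i) x := rfl

theorem continuous_polyVec (f : Fin 2 → MvPolynomial (Fin 2) ℝ) : Continuous (polyVec f) :=
  (PiLp.continuous_toLp 2 _).comp (continuous_pi fun i => continuous_polyFun (f i))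

/-- A polynomial vector field as an element of `L²` of the unit disk. -/
noncomputable def polyField (f : Fin 2 → MvPolynomial (Fin 2) ℝ) : L2Field unitDisk :=
  (memLp_of_continuous (continuous_polyVec f)).toLp (polyVec f)

theorem coeFn_polyField (f : Fin 2 → MvPolynomial (Fin 2) ℝ) :
    polyField f =ᵐ[volume.restrict unitDisk] polyVec f :=
  MemLp.coeFn_toLp (memLp_of_continuous (continuous_polyVec f))

theorem inner_polyL2 (u : L2Scalar unitDisk) (p : MvPolynomial (Fin 2) ℝ) :
    inner ℝ u (polyL2 p) = ∫ x in unitDisk, u x * polyFun p x := by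
  refine (inner_toLp u (memLp_of_continuous (continuous_polyFun p))).trans ?_
  simp only [RCLike.inner_apply, conj_trivial, mul_comm]

theorem inner_polyField (G : L2Field unitDisk) (f : Fin 2 → MvPolynomial (Fin 2) ℝ) :
    inner ℝ G (polyField f) = ∫ x in unitDisk, ∑ i, G x i * polyFun (f i) x := by
  refine (inner_toLp G (memLp_of_continuous (continuous_polyVec f))).trans ?_
  simp only [PiLp.inner_apply, RCLike.inner_apply, conj_trivial, polyVec_apply, mul_comm]

/-- The classical gradient of a polynomial is its weak gradient. -/
theorem isWeakGradient_polyL2 (p : MvPolynomial (Fin 2) ℝ) :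
    IsWeakGradient unitDisk (polyL2 p) (polyField fun i => pderiv i p) := by
  intro φ hφ hc hs w
  have h1 : ∫ x in unitDisk, polyL2 p x * fderiv ℝ φ x w
      = ∫ x, polyFun p x * fderiv ℝ φ x w := by
    refine Eq.trans ?_ (setIntegral_eq_integral_of_forall_compl_eq_zero (s := unitDisk) ?_)
    · refine integral_congr_ae ?_
      filter_upwards [coeFn_polyL2 p] with x hx
      rw [hx]
    · intro x hx
      have : x ∉ tsupport (fderiv ℝ φ) := fun h => hx (hs (tsupport_fderiv_subset ℝ h))
      rw [image_eq_zero_of_notMem_tsupport this]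
      simp
  have h2 : ∫ x in unitDisk, inner ℝ (polyField (fun i => pderiv i p) x) w * φ x
      = ∫ x, fderiv ℝ (polyFun p) x w * φ x := by
    refine Eq.trans ?_ (setIntegral_eq_integral_of_forall_compl_eq_zero (s := unitDisk) ?_)
    · refine integral_congr_ae ?_
      filter_upwards [coeFn_polyField fun i => pderiv i p] with x hx
      rw [hx, fderiv_polyFun, PiLp.inner_apply]
      simp [mul_comm]
    · intro x hx
      rw [image_eq_zero_of_notMem_tsupport fun h => hx (hs h), mul_zero]
  rw [h1, h2]
  have c1 : Continuous fun x => fderiv ℝ φ x w :=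
    (hφ.continuous_fderiv (by simp)).clm_apply continuous_const
  have c2 : Continuous fun x => fderiv ℝ (polyFun p) x w :=
    ((contDiff_polyFun p (n := 1)).continuous_fderiv (by simp)).clm_apply continuous_const
  refine integral_mul_fderiv_eq_neg_fderiv_mul_of_integrable ?_ ?_ ?_ ?_ ?_
  · exact (c2.mul hφ.continuous).integrable_of_hasCompactSupport hc.mul_left
  · exact ((continuous_polyFun p).mul c1).integrable_of_hasCompactSupport
      (hc.fderiv_apply (𝕜 := ℝ) w).mul_left
  · exact ((continuous_polyFun p).mul hφ.continuous).integrable_of_hasCompactSupport hc.mul_left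
  · exact fun x _ => (hasFDerivAt_polyFun p x).differentiableAt
  · exact fun x _ => hφ.differentiable (by simp) x

/-- Stone–Weierstrass on the closed disk. -/
theorem exists_polyFun_near {f : Plane → ℝ} (hf : Continuous f) {ε : ℝ} (hε : 0 < ε) :
    ∃ p, ∀ x ∈ unitDisk, |f x - polyFun p x| < ε := by
  have : CompactSpace (Metric.closedBall (0 : Plane) 1) :=
    isCompact_iff_compactSpace.1 (isCompact_closedBall 0 1)
  let coord : Fin 2 → C(Metric.closedBall (0 : Plane) 1, ℝ) := fun i =>
    ⟨fun x => (x : Plane) i, by fun_prop⟩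
  let A : Subalgebra ℝ C(Metric.closedBall (0 : Plane) 1, ℝ) :=
    (aeval coord : MvPolynomial (Fin 2) ℝ →ₐ[ℝ] _).range
  have hA : A.SeparatesPoints := by
    intro x y hxy
    have : ∃ i, (x : Plane) i ≠ (y : Plane) i := by
      by_contra! hcon
      exact hxy (Subtype.ext (PiLp.ext hcon))
    obtain ⟨i, hi⟩ := this
    exact ⟨_, ⟨coord i, ⟨X i, aeval_X _ _⟩, rfl⟩, hi⟩
  have hd := ContinuousMap.subalgebra_topologicalClosure_eq_top_of_separatesPoints A hA
  let F : C(Metric.closedBall (0 : Plane) 1, ℝ) := ⟨fun x => f x, by fun_prop⟩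
  have hF : F ∈ closure (A : Set C(Metric.closedBall (0 : Plane) 1, ℝ)) := by
    have : F ∈ A.topologicalClosure := by rw [hd]; trivial
    exact this
  obtain ⟨_, ⟨p, rfl⟩, hp⟩ := Metric.mem_closure_iff.1 hF ε hε
  refine ⟨p, fun x hx => ?_⟩
  have h1 := (ContinuousMap.dist_lt_iff hε).1 hp ⟨x, Metric.ball_subset_closedBall hx⟩
  have h2 : ∀ y : Metric.closedBall (0 : Plane) 1, (aeval coord p) y = polyFun p y := by
    intro y
    have := congrArg (fun g => g p) (MvPolynomial.comp_aeval (R := ℝ) coord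
      (ContinuousMap.evalAlgHom ℝ ℝ y))
    simp only [AlgHom.comp_apply] at this
    exact this
  rw [Real.dist_eq] at h1
  change |f x - (aeval coord p) ⟨x, _⟩| < ε at h1
  rwa [h2] at h1

theorem eq_zero_of_forall_inner_polyL2 {u : L2Scalar unitDisk}
    (h : ∀ p, inner ℝ u (polyL2 p) = 0) : u = 0 := by
  have hu : Integrable u (volume.restrict unitDisk) :=
    (Lp.memLp u).integrable (by norm_num)
  have key : ∀ f : Plane → ℝ, Continuous f → ∫ x in unitDisk, u x * f x = 0 := by
    intro f hf
    have hi : ∀ {g : Plane → ℝ}, Continuous g →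
        Integrable (fun x => u x * g x) (volume.restrict unitDisk) := fun hg =>
      (Lp.memLp u).integrable_mul (memLp_of_continuous hg)
    by_contra hne
    set I := ∫ x in unitDisk, ‖u x‖
    have hI : 0 ≤ I := integral_nonneg fun _ => norm_nonneg _
    -- The tolerance makes the error at most `I / (I + 1)` times the integral, which is strictly
    -- smaller than the integral itself.
    obtain ⟨p, hp⟩ := exists_polyFun_near hf
      (ε := |∫ x in unitDisk, u x * f x| / (I + 1)) (by positivity)
    have h1 : ∫ x in unitDisk, u x * f x = ∫ x in unitDisk, u x * (f x - polyFun p x) := by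
      simp only [mul_sub]
      rw [integral_sub (hi hf) (hi (continuous_polyFun p)), ← inner_polyL2, h, sub_zero]
    have h2 : |∫ x in unitDisk, u x * f x| ≤
        I * (|∫ x in unitDisk, u x * f x| / (I + 1)) := by
      conv_lhs => rw [h1, ← Real.norm_eq_abs]
      rw [← integral_mul_const]
      refine norm_integral_le_of_norm_le (hu.norm.mul_const _) ?_
      filter_upwards [ae_restrict_mem measurableSet_ball] with x hx
      rw [norm_mul]
      gcongr
      exact (hp x hx).le
    have h3 : 0 < |∫ x in unitDisk, u x * f x| := by positivity
    rw [mul_div_assoc', le_div_iff₀ (by positivity)] at h2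
    nlinarith
  have h0 : ∀ᵐ x ∂(volume : Measure Plane), x ∈ unitDisk → u x = 0 := by
    refine Metric.isOpen_ball.ae_eq_zero_of_integral_contDiff_smul_eq_zero
      (IntegrableOn.locallyIntegrableOn hu) fun g hg hc hs => ?_
    rw [← setIntegral_eq_integral_of_forall_compl_eq_zero (s := unitDisk)]
    · rw [← key g hg.continuous]
      simp only [smul_eq_mul, mul_comm]
    · intro x hx
      rw [image_eq_zero_of_notMem_tsupport fun h => hx (hs h), zero_smul]
  rw [Lp.eq_zero_iff_ae_eq_zero]
  exact (ae_restrict_iff' measurableSet_ball).2 h0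

theorem exists_polyL2_near (u : L2Scalar unitDisk) {ε : ℝ} (hε : 0 < ε) :
    ∃ p, ‖u - polyL2 p‖ < ε := by
  have h1 : (LinearMap.range polyL2).topologicalClosure = ⊤ := by
    rw [Submodule.topologicalClosure_eq_top_iff, Submodule.eq_bot_iff]
    intro v hv
    refine eq_zero_of_forall_inner_polyL2 fun p => ?_
    exact Submodule.inner_left_of_mem_orthogonal (LinearMap.mem_range_self polyL2 p) hv
  have h2 : u ∈ closure (LinearMap.range polyL2 : Set (L2Scalar unitDisk)) := by
    rw [← Submodule.topologicalClosure_coe, h1]; trivial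
  obtain ⟨_, ⟨p, rfl⟩, hp⟩ := Metric.mem_closure_iff.1 h2 ε hε
  exact ⟨p, by rwa [← dist_eq_norm]⟩

theorem polyL2_injective : Function.Injective polyL2 := by
  rw [← LinearMap.ker_eq_bot, LinearMap.ker_eq_bot']
  intro p hp
  have h0 : polyFun p =ᵐ[volume.restrict unitDisk] 0 :=
    (coeFn_polyL2 p).symm.trans (by rw [hp]; exact Lp.coeFn_zero _ _ _)
  have h1 : Set.EqOn (polyFun p) 0 unitDisk :=
    Measure.eqOn_open_of_ae_eq h0 Metric.isOpen_ball (continuous_polyFun p).continuousOn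
      continuousOn_const
  -- The square with side `(-1/2, 1/2)` lies in the disk and is a product of infinite sets, so
  -- vanishing on it determines the polynomial.
  refine funext_set (fun _ => Set.Ioo (-(1/2) : ℝ) (1/2)) (fun _ => Set.Ioo_infinite (by norm_num))
    fun x hx => ?_
  rw [map_zero]
  refine h1 (x := WithLp.toLp 2 x) ?_
  have a := hx 0 trivial
  have b := hx 1 trivial
  rw [Set.mem_Ioo] at a b
  rw [mem_ball_zero_iff, EuclideanSpace.norm_eq, Real.sqrt_lt' one_pos]
  simp only [Fin.sum_univ_two, Real.norm_eq_abs, sq_abs]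
  nlinarith

end Polynomials

/-! ### Integration by parts against fields tangent to the circle. -/

section TangentialFields

open MvPolynomial

/-- With `t = n r - 1` and `r = 1 - |x|²` this bounds `n r` times the slope of the cutoff uniformly
in `n`: a slope of order `n` is harmless against a normal component of order `r`. -/
theorem exists_bound_deriv_smoothTransition :
    ∃ M : ℝ, ∀ t, |deriv Real.smoothTransition t * (t + 1)| ≤ M := by
  have hz : ∀ t ∉ Set.Icc (0 : ℝ) 1, deriv Real.smoothTransition t = 0 := by
    intro t ht
    rw [Set.mem_Icc, not_and_or, not_le, not_le] at ht
    rcases ht with ht | ht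
    · have : Real.smoothTransition =ᶠ[nhds t] fun _ => 0 := by
        filter_upwards [Iio_mem_nhds ht] with s hs
        exact Real.smoothTransition.zero_of_nonpos (le_of_lt hs)
      rw [this.deriv_eq, deriv_const]
    · have : Real.smoothTransition =ᶠ[nhds t] fun _ => 1 := by
        filter_upwards [Ioi_mem_nhds ht] with s hs
        exact Real.smoothTransition.one_of_one_le (le_of_lt hs)
      rw [this.deriv_eq, deriv_const]
  have hc : Continuous (deriv Real.smoothTransition) :=
    (Real.smoothTransition.contDiff (n := 1)).continuous_deriv (by simp)
  obtain ⟨M, hM⟩ := (isCompact_Icc (a := (0 : ℝ)) (b := 1)).exists_bound_of_continuousOn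
    (f := fun t => deriv Real.smoothTransition t * (t + 1)) (by fun_prop)
  refine ⟨max M 0, fun t => ?_⟩
  by_cases ht : t ∈ Set.Icc (0 : ℝ) 1
  · exact (hM t ht).trans (le_max_left _ _)
  · rw [hz t ht]
    simp

/-- The polynomial `1 - x² - y²` vanishing on the unit circle. -/
noncomputable def circlePoly : MvPolynomial (Fin 2) ℝ :=
  1 - (X 0 * X 0 + X 1 * X 1)

@[simp] theorem polyFun_circlePoly (x : Plane) : polyFun circlePoly x = 1 - ‖x‖ ^ 2 := by
  rw [EuclideanSpace.norm_sq_eq]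
  simp [circlePoly, ← pow_two]

/-- Smooth cutoffs of the unit disk. -/
noncomputable def diskCutoff (n : ℕ) (x : Plane) : ℝ :=
  Real.smoothTransition (n * polyFun circlePoly x - 1)

theorem contDiff_diskCutoff (n : ℕ) : ContDiff ℝ ∞ (diskCutoff n) :=
  Real.smoothTransition.contDiff.comp ((contDiff_const.mul (contDiff_polyFun _)).sub contDiff_const)

theorem abs_diskCutoff_le_one (n : ℕ) (x : Plane) : |diskCutoff n x| ≤ 1 := by
  rw [diskCutoff, abs_of_nonneg (Real.smoothTransition.nonneg _)]
  exact Real.smoothTransition.le_one _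

theorem fderiv_diskCutoff (n : ℕ) (x w : Plane) :
    fderiv ℝ (diskCutoff n) x w =
      deriv Real.smoothTransition (n * polyFun circlePoly x - 1) * (n * (-2 * ∑ i, x i * w i)) := by
  have h1 : HasFDerivAt (fun x => (n : ℝ) * polyFun circlePoly x - 1)
      ((n : ℝ) • ∑ i, polyFun (pderiv i circlePoly) x • (EuclideanSpace.proj i : Plane →L[ℝ] ℝ)) x :=
    ((hasFDerivAt_polyFun circlePoly x).const_mul _).sub_const _
  have h2 : HasDerivAt Real.smoothTransition
      (deriv Real.smoothTransition (n * polyFun circlePoly x - 1))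
      (n * polyFun circlePoly x - 1) :=
    ((Real.smoothTransition.contDiff (n := 1)).differentiable (by simp) _).hasDerivAt
  have h3 := h2.comp_hasFDerivAt x h1
  change fderiv ℝ (Real.smoothTransition ∘ fun x => (n : ℝ) * polyFun circlePoly x - 1) x w = _
  rw [h3.fderiv]
  simp [circlePoly, Fin.sum_univ_two, pderiv_X, Pi.single_apply]
  ring

theorem tsupport_diskCutoff_mul_subset (n : ℕ) (f : Plane → ℝ) :
    tsupport (fun x => diskCutoff n x * f x) ⊆ {x | 1 ≤ n * (1 - ‖x‖ ^ 2)} := by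
  refine closure_minimal (fun x hx => ?_)
    (isClosed_le continuous_const (by fun_prop))
  by_contra hlt
  rw [Set.mem_ofPred_eq, not_le] at hlt
  refine hx ?_
  simp only
  rw [diskCutoff, Real.smoothTransition.zero_of_nonpos, zero_mul]
  rw [polyFun_circlePoly]
  linarith

theorem mem_unitDisk_of_one_le {n : ℕ} {x : Plane} (hx : 1 ≤ n * (1 - ‖x‖ ^ 2)) :
    x ∈ unitDisk := by
  rw [mem_ball_zero_iff]
  have : 0 < 1 - ‖x‖ ^ 2 := by
    by_contra! h
    nlinarith [(Nat.cast_nonneg n : (0 : ℝ) ≤ n)]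
  nlinarith [norm_nonneg x]

theorem tendsto_diskCutoff {x : Plane} (hx : x ∈ unitDisk) :
    (∀ᶠ n : ℕ in Filter.atTop, diskCutoff n x = 1) ∧
    ∀ᶠ n : ℕ in Filter.atTop,
      deriv Real.smoothTransition (n * polyFun circlePoly x - 1) = 0 := by
  rw [mem_ball_zero_iff] at hx
  have hr : 0 < polyFun circlePoly x := by
    rw [polyFun_circlePoly]
    nlinarith [norm_nonneg x]
  have h := (tendsto_natCast_atTop_atTop (R := ℝ)).atTop_mul_const hr
  have h2 : ∀ᶠ n : ℕ in Filter.atTop, 2 < (n : ℝ) * polyFun circlePoly x :=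
    h.eventually_gt_atTop 2
  constructor
  · filter_upwards [h2] with n hn
    exact Real.smoothTransition.one_of_one_le (by linarith)
  · filter_upwards [h2] with n hn
    have : Real.smoothTransition =ᶠ[nhds (n * polyFun circlePoly x - 1)] fun _ => 1 := by
      filter_upwards [Ioi_mem_nhds (show (1 : ℝ) < n * polyFun circlePoly x - 1 by linarith)]
        with s hs
      exact Real.smoothTransition.one_of_one_le (le_of_lt hs)
    rw [this.deriv_eq, deriv_const]

/-- **Divergence theorem** for a weak gradient and a polynomial field tangent to the circle. -/
theorem inner_polyField_of_tangent {u : L2Scalar unitDisk} {G : L2Field unitDisk}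
    (hG : IsWeakGradient unitDisk u G) {f : Fin 2 → MvPolynomial (Fin 2) ℝ}
    {s : MvPolynomial (Fin 2) ℝ} (hs : X 0 * f 0 + X 1 * f 1 = circlePoly * s) :
    inner ℝ G (polyField f) = - inner ℝ u (polyL2 (pderiv 0 (f 0) + pderiv 1 (f 1))) := by
  obtain ⟨M, hM⟩ := exists_bound_deriv_smoothTransition
  have hM0 : 0 ≤ M := (abs_nonneg _).trans (hM 0)
  set d : MvPolynomial (Fin 2) ℝ := pderiv 0 (f 0) + pderiv 1 (f 1) with hd
  let e : Fin 2 → Plane := fun i => EuclideanSpace.single i 1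
  let h : ℕ → Plane → ℝ := fun n x => deriv Real.smoothTransition (n * polyFun circlePoly x - 1) *
    (n * polyFun circlePoly x)
  have hh : ∀ n x, |h n x| ≤ M := fun n x => by
    have := hM (n * polyFun circlePoly x - 1)
    rwa [sub_add_cancel] at this
  -- Divergence of the cut-off field. Tangency turns `∇χ · f` into `-2 h s`, where `h` is bounded by
  -- `M` and eventually zero at each point of the disk.
  have hder : ∀ n x, ∑ i, fderiv ℝ (fun y => diskCutoff n y * polyFun (f i) y) x (e i)
      = diskCutoff n x * polyFun d x - 2 * h n x * polyFun s x := by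
    intro n x
    have hx : x 0 * polyFun (f 0) x + x 1 * polyFun (f 1) x
        = polyFun circlePoly x * polyFun s x := by
      simpa using congrArg (fun p => polyFun p x) hs
    have h1 : ∀ i, fderiv ℝ (fun y => diskCutoff n y * polyFun (f i) y) x (e i)
        = diskCutoff n x * polyFun (pderiv i (f i)) x + polyFun (f i) x *
          (deriv Real.smoothTransition (n * polyFun circlePoly x - 1) * (n * (-2 * x i))) := by
      intro i
      rw [fderiv_fun_mul ((contDiff_diskCutoff n).differentiable (by simp) x)
        (hasFDerivAt_polyFun (f i) x).differentiableAt]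
      simp only [add_apply, smul_apply, smul_eq_mul]
      rw [fderiv_diskCutoff, fderiv_polyFun]
      simp [e]
    simp only [h1, Fin.sum_univ_two, hd, polyFun_add, h]
    linear_combination (-2 * n * deriv Real.smoothTransition (n * polyFun circlePoly x - 1)) * hx
  have hcs : ∀ n i, HasCompactSupport (fun y => diskCutoff n y * polyFun (f i) y) := fun n i =>
    (isCompact_closedBall (0 : Plane) 1).of_isClosed_subset (isClosed_tsupport _) fun x hx =>
      Metric.ball_subset_closedBall
        (mem_unitDisk_of_one_le (tsupport_diskCutoff_mul_subset n _ hx))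
  have hsm : ∀ n i, ContDiff ℝ ∞ (fun y => diskCutoff n y * polyFun (f i) y) := fun n i =>
    (contDiff_diskCutoff n).mul (contDiff_polyFun _)
  have hdc : ∀ n i, Continuous fun x =>
      fderiv ℝ (fun y => diskCutoff n y * polyFun (f i) y) x (e i) := fun n i =>
    ((hsm n i).continuous_fderiv (by simp)).clm_apply continuous_const
  have hu : Integrable u (volume.restrict unitDisk) := (Lp.memLp u).integrable (by norm_num)
  have hGi : ∀ i, MemLp (fun x => G x i) 2 (volume.restrict unitDisk) := fun i =>
    (EuclideanSpace.proj i : Plane →L[ℝ] ℝ).comp_memLp' (Lp.memLp G)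
  have hstep : ∀ n, ∫ x in unitDisk, u x * (diskCutoff n x * polyFun d x - 2 * h n x * polyFun s x)
      = - ∫ x in unitDisk, diskCutoff n x * ∑ i, G x i * polyFun (f i) x := by
    intro n
    have h1 := fun i => hG _ (hsm n i) (hcs n i)
      (fun x hx => mem_unitDisk_of_one_le (tsupport_diskCutoff_mul_subset n _ hx)) (e i)
    simp only [← hder, Finset.mul_sum]
    rw [integral_finsetSum, integral_finsetSum, ← Finset.sum_neg_distrib]
    · refine Finset.sum_congr rfl fun i _ => ?_
      rw [h1 i]
      refine congrArg _ (integral_congr_ae (.of_forall fun x => ?_))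
      simp [e, EuclideanSpace.inner_single_right]
      ring
    · intro i _
      refine ((hGi i).integrable_mul (memLp_of_continuous (hsm n i).continuous)).congr
        (.of_forall fun x => ?_)
      simp only [Pi.mul_apply]
      ring
    · exact fun i _ => (Lp.memLp u).integrable_mul (memLp_of_continuous (hdc n i))
  have hA : Filter.Tendsto (fun n => ∫ x in unitDisk,
      u x * (diskCutoff n x * polyFun d x - 2 * h n x * polyFun s x)) Filter.atTop
      (nhds (∫ x in unitDisk, u x * polyFun d x)) := by
    refine tendsto_integral_of_dominated_convergence
      (fun x => ‖u x‖ * (|polyFun d x| + 2 * M * |polyFun s x|)) ?_ ?_ ?_ ?_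
    · intro n
      simp only [← hder]
      exact (Lp.aestronglyMeasurable u).mul
        (continuous_finsetSum _ fun i _ => hdc n i).aestronglyMeasurable
    · refine (Lp.memLp u).norm.integrable_mul (memLp_of_continuous ?_)
      exact (continuous_polyFun d).abs.add (continuous_const.mul (continuous_polyFun s).abs)
    · intro n
      refine .of_forall fun x => ?_
      rw [norm_mul, Real.norm_eq_abs (_ - _)]
      gcongr
      refine (abs_sub _ _).trans ?_
      rw [abs_mul, abs_mul, abs_mul, abs_two]
      have := abs_diskCutoff_le_one n x
      have := hh n x
      gcongr
      nlinarith [abs_nonneg (polyFun d x)]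
    · filter_upwards [ae_restrict_mem measurableSet_ball] with x hx
      refine tendsto_const_nhds.congr' ?_
      filter_upwards [(tendsto_diskCutoff hx).1, (tendsto_diskCutoff hx).2] with n h1 h2
      rw [h1]
      simp only [h]
      rw [h2]
      ring
  have hB : Filter.Tendsto (fun n => ∫ x in unitDisk, diskCutoff n x * ∑ i, G x i * polyFun (f i) x)
      Filter.atTop (nhds (∫ x in unitDisk, ∑ i, G x i * polyFun (f i) x)) := by
    have hint : Integrable (fun x => ∑ i, G x i * polyFun (f i) x) (volume.restrict unitDisk) :=
      integrable_finsetSum _ fun i _ =>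
        (hGi i).integrable_mul (memLp_of_continuous (continuous_polyFun (f i)))
    refine tendsto_integral_of_dominated_convergence (fun x => ‖∑ i, G x i * polyFun (f i) x‖)
      ?_ hint.norm ?_ ?_
    · exact fun n => (contDiff_diskCutoff n).continuous.aestronglyMeasurable.mul
        hint.aestronglyMeasurable
    · intro n
      refine .of_forall fun x => ?_
      rw [norm_mul]
      exact mul_le_of_le_one_left (norm_nonneg _) (abs_diskCutoff_le_one n x)
    · filter_upwards [ae_restrict_mem measurableSet_ball] with x hx
      refine tendsto_const_nhds.congr' ?_
      filter_upwards [(tendsto_diskCutoff hx).1] with n h1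
      simp [h1]
  rw [inner_polyL2, inner_polyField]
  have := tendsto_nhds_unique (hA.congr hstep) hB.neg
  rw [this, neg_neg]

end TangentialFields

/-! ### The orthogonal-polynomial operator and the Poincaré inequality. -/

section DiskOperator

open MvPolynomial

/-- The Euler operator `x ∂ₓ + y ∂_y`. -/
noncomputable def eulerOp : MvPolynomial (Fin 2) ℝ →ₗ[ℝ] MvPolynomial (Fin 2) ℝ :=
  ∑ i, LinearMap.mulLeft ℝ (X i) ∘ₗ (pderiv i : Derivation ℝ _ _).toLinearMap

theorem eulerOp_apply (p : MvPolynomial (Fin 2) ℝ) : eulerOp p = ∑ i, X i * pderiv i p := by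
  simp [eulerOp]

/-- The field `(I - x xᵀ) ∇p`, tangent to the unit circle. -/
noncomputable def diskField (p : MvPolynomial (Fin 2) ℝ) (i : Fin 2) : MvPolynomial (Fin 2) ℝ :=
  pderiv i p - X i * eulerOp p

/-- The operator `div ((I - x xᵀ) ∇p)`, whose eigenfunctions are the orthogonal polynomials of
the unit disk. -/
noncomputable def diskOp : MvPolynomial (Fin 2) ℝ →ₗ[ℝ] MvPolynomial (Fin 2) ℝ :=
  ∑ i, (pderiv i : Derivation ℝ _ _).toLinearMap ∘ₗ
    ((pderiv i : Derivation ℝ _ _).toLinearMap - LinearMap.mulLeft ℝ (X i) ∘ₗ eulerOp)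

theorem diskOp_apply (p : MvPolynomial (Fin 2) ℝ) :
    diskOp p = pderiv 0 (diskField p 0) + pderiv 1 (diskField p 1) := by
  simp [diskOp, diskField]

theorem diskField_tangent (p : MvPolynomial (Fin 2) ℝ) :
    X 0 * diskField p 0 + X 1 * diskField p 1 = circlePoly * eulerOp p := by
  simp only [diskField, circlePoly, eulerOp_apply, Fin.sum_univ_two]
  ring

theorem inner_polyField_diskField {u : L2Scalar unitDisk} {G : L2Field unitDisk}
    (hG : IsWeakGradient unitDisk u G) (p : MvPolynomial (Fin 2) ℝ) :
    inner ℝ G (polyField (diskField p)) = - inner ℝ u (polyL2 (diskOp p)) := by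
  rw [inner_polyField_of_tangent hG (diskField_tangent p), diskOp_apply]

theorem inner_polyField_polyField (f g : Fin 2 → MvPolynomial (Fin 2) ℝ) :
    inner ℝ (polyField f) (polyField g) =
      ∫ x in unitDisk, ∑ i, polyFun (f i) x * polyFun (g i) x := by
  rw [inner_polyField]
  refine integral_congr_ae ?_
  filter_upwards [coeFn_polyField f] with x hx
  simp [hx]

/-- Both sides are `-∫ ∇p · (I - x xᵀ)∇q`, with a symmetric matrix. -/
theorem inner_diskOp_symm (p q : MvPolynomial (Fin 2) ℝ) :
    inner ℝ (polyL2 p) (polyL2 (diskOp q)) = inner ℝ (polyL2 (diskOp p)) (polyL2 q) := by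
  rw [real_inner_comm (polyL2 q)]
  apply neg_injective
  rw [← inner_polyField_diskField (isWeakGradient_polyL2 p),
    ← inner_polyField_diskField (isWeakGradient_polyL2 q),
    inner_polyField_polyField, inner_polyField_polyField]
  refine integral_congr_ae (.of_forall fun x => ?_)
  simp [diskField, eulerOp_apply, Fin.sum_univ_two]
  ring

/-- With `A = I - x xᵀ`, one has `A - A² = (1 - |x|²) x xᵀ ≥ 0` in the disk, so `|A∇p|² ≤ ∇p · A∇p`
pointwise. -/
theorem norm_sq_polyField_diskField_le (p : MvPolynomial (Fin 2) ℝ) :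
    ‖polyField (diskField p)‖ ^ 2 ≤ - inner ℝ (polyL2 p) (polyL2 (diskOp p)) := by
  rw [← inner_polyField_diskField (isWeakGradient_polyL2 p), ← real_inner_self_eq_norm_sq,
    inner_polyField_polyField, inner_polyField_polyField]
  have hi : ∀ f g : Fin 2 → MvPolynomial (Fin 2) ℝ,
      Integrable (fun x => ∑ i, polyFun (f i) x * polyFun (g i) x) (volume.restrict unitDisk) :=
    fun f g => (memLp_of_continuous (continuous_finsetSum _ fun i _ =>
      (continuous_polyFun (f i)).mul (continuous_polyFun (g i)))).integrable (by norm_num)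
  refine integral_mono_ae (hi _ _) (hi _ _) ?_
  filter_upwards [ae_restrict_mem measurableSet_ball] with x hx
  have h1 : x 0 ^ 2 + x 1 ^ 2 ≤ 1 := by
    rw [mem_ball_zero_iff, EuclideanSpace.norm_eq, Real.sqrt_lt' one_pos] at hx
    simpa using hx.le
  simp only [diskField, eulerOp_apply, Fin.sum_univ_two, polyFun_sub, polyFun_mul, polyFun_add,
    polyFun_X]
  set a := polyFun (pderiv 0 p) x
  set b := polyFun (pderiv 1 p) x
  nlinarith [mul_nonneg (sub_nonneg.2 h1) (sq_nonneg (x 0 * a + x 1 * b))]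

/-- By Euler's identity `div (x (k p)) = k (k + 2) p` in the plane; only the Laplacian remains, and
it lowers the degree by two. -/
theorem diskOp_add_smul_of_isHomogeneous {p : MvPolynomial (Fin 2) ℝ} {k : ℕ}
    (hp : p.IsHomogeneous k) :
    diskOp p + ((k : ℝ) * (k + 2)) • p = ∑ i, pderiv i (pderiv i p) := by
  have hE : eulerOp p = C (k : ℝ) * p := by
    rw [eulerOp_apply, hp.sum_X_mul_pderiv]
    simp [nsmul_eq_mul]
  have h := eulerOp_apply p
  rw [hE, Fin.sum_univ_two] at h
  rw [diskOp_apply, diskField, diskField, hE, smul_eq_C_mul]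
  simp only [map_sub, Derivation.leibniz, pderiv_X, pderiv_C, smul_eq_mul, Fin.sum_univ_two,
    map_mul, map_add, map_ofNat, Pi.single_apply, mul_zero, add_zero, if_true]
  linear_combination C (k : ℝ) * h

theorem diskOp_add_smul_mem {p : MvPolynomial (Fin 2) ℝ} {n : ℕ}
    (hp : p ∈ restrictTotalDegree (Fin 2) ℝ (n + 1)) :
    diskOp p + (((n : ℝ) + 1) * (n + 3)) • p ∈ restrictTotalDegree (Fin 2) ℝ n := by
  have hp' := (mem_restrictTotalDegree _ _ _).1 hp
  rw [← sum_homogeneousComponent p, map_sum, Finset.smul_sum, ← Finset.sum_add_distrib]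
  refine Submodule.sum_mem _ fun k hk => ?_
  have hh := homogeneousComponent_isHomogeneous k p
  set q := homogeneousComponent k p
  have hkn : k ≤ n + 1 := by
    rw [Finset.mem_range] at hk
    omega
  have e : diskOp q + (((n : ℝ) + 1) * (n + 3)) • q = ∑ i, pderiv i (pderiv i q) +
      (((n : ℝ) + 1) * (n + 3) - k * (k + 2)) • q := by
    rw [← diskOp_add_smul_of_isHomogeneous hh, sub_smul]
    abel
  rw [e]
  refine Submodule.add_mem _ (Submodule.sum_mem _ fun i _ => ?_) ?_
  · rw [mem_restrictTotalDegree]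
    refine (hh.pderiv.pderiv).totalDegree_le.trans ?_
    omega
  · rcases hkn.lt_or_eq with h | h
    · refine Submodule.smul_mem _ _ ((mem_restrictTotalDegree _ _ _).2 ?_)
      exact hh.totalDegree_le.trans (by omega)
    · have : ((n : ℝ) + 1) * (n + 3) - k * (k + 2) = 0 := by
        rw [h]; push_cast; ring
      rw [this, zero_smul]
      exact Submodule.zero_mem _

theorem restrictTotalDegree_mono {m n : ℕ} (h : m ≤ n) :
    restrictTotalDegree (Fin 2) ℝ m ≤ restrictTotalDegree (Fin 2) ℝ n := fun p hp => by
  rw [mem_restrictTotalDegree] at hp ⊢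
  exact hp.trans h

theorem diskOp_mem {p : MvPolynomial (Fin 2) ℝ} {n : ℕ}
    (hp : p ∈ restrictTotalDegree (Fin 2) ℝ n) : diskOp p ∈ restrictTotalDegree (Fin 2) ℝ n := by
  rcases n with _ | n
  · have h0 : diskOp p = 0 := by
      rw [mem_restrictTotalDegree, Nat.le_zero, totalDegree_eq_zero_iff_eq_C] at hp
      rw [hp]
      simp [diskOp_apply, diskField, eulerOp_apply]
    rw [h0]
    exact Submodule.zero_mem _
  · have h := Submodule.sub_mem _ (restrictTotalDegree_mono n.le_succ (diskOp_add_smul_mem hp))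
      (Submodule.smul_mem _ (((n : ℝ) + 1) * (n + 3)) hp)
    rwa [add_sub_cancel_right] at h

instance (n : ℕ) : FiniteDimensional ℝ (restrictTotalDegree (Fin 2) ℝ n) := by
  have hfin : Set.Finite {s : Fin 2 →₀ ℕ | (s.sum fun _ e => e) ≤ n} := by
    refine (Set.finite_Iic (Finsupp.equivFunOnFinite.symm fun _ => n)).subset fun s hs i => ?_
    rw [Set.mem_ofPred_eq, Finsupp.sum_fintype _ _ (fun _ => rfl)] at hs
    exact (Finset.single_le_sum (fun _ _ => Nat.zero_le _) (Finset.mem_univ i)).trans hs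
  rw [restrictTotalDegree, restrictSupport, AddMonoidAlgebra.supported_eq_span_single]
  exact FiniteDimensional.span_of_finite ℝ (hfin.image _)

/-- The polynomials of degree at most `n` in `L²` of the unit disk. -/
noncomputable def polySpace (n : ℕ) : Submodule ℝ (L2Scalar unitDisk) :=
  (restrictTotalDegree (Fin 2) ℝ n).map polyL2

instance (n : ℕ) : FiniteDimensional ℝ (polySpace n) :=
  inferInstanceAs (FiniteDimensional ℝ ((restrictTotalDegree (Fin 2) ℝ n).map polyL2))

theorem polySpace_mono {m n : ℕ} (h : m ≤ n) : polySpace m ≤ polySpace n :=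
  Submodule.map_mono (restrictTotalDegree_mono h)

theorem polyL2_mem_polySpace {p : MvPolynomial (Fin 2) ℝ} {n : ℕ}
    (hp : p ∈ restrictTotalDegree (Fin 2) ℝ n) : polyL2 p ∈ polySpace n :=
  Submodule.mem_map_of_mem hp

/-- `L p + (n + 1)(n + 3) p` has degree at most `n`, and by symmetry of `L` it is orthogonal to that
space; hence it is zero. -/
theorem polyL2_diskOp_of_orthogonal {p : MvPolynomial (Fin 2) ℝ} {n : ℕ}
    (hp : p ∈ restrictTotalDegree (Fin 2) ℝ (n + 1)) (ho : polyL2 p ∈ (polySpace n)ᗮ) :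
    polyL2 (diskOp p) = -(((n : ℝ) + 1) * (n + 3)) • polyL2 p := by
  have h1 : polyL2 (diskOp p + (((n : ℝ) + 1) * (n + 3)) • p) ∈ polySpace n :=
    polyL2_mem_polySpace (diskOp_add_smul_mem hp)
  have h2 : polyL2 (diskOp p + (((n : ℝ) + 1) * (n + 3)) • p) ∈ (polySpace n)ᗮ := by
    rw [map_add, map_smul]
    refine Submodule.add_mem _ ?_ (Submodule.smul_mem _ _ ho)
    rintro _ ⟨q, hq, rfl⟩
    rw [inner_diskOp_symm]
    exact ho _ (polyL2_mem_polySpace (diskOp_mem hq))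
  have h3 : polyL2 (diskOp p + (((n : ℝ) + 1) * (n + 3)) • p) = 0 :=
    inner_self_eq_zero.1 (h2 _ h1)
  rw [map_add, map_smul] at h3
  rw [neg_smul]
  exact eq_neg_of_add_eq_zero_left h3

/-- Split off the part of top degree orthogonal to all lower degrees. It is an eigenvector with a
larger constant, and its cross terms with the rest vanish. -/
theorem diskOp_coercive (N m : ℕ) {p : MvPolynomial (Fin 2) ℝ}
    (hp : p ∈ restrictTotalDegree (Fin 2) ℝ (N + m)) (ho : polyL2 p ∈ (polySpace N)ᗮ) :
    ((N : ℝ) + 1) * (N + 3) * ‖polyL2 p‖ ^ 2 ≤ - inner ℝ (polyL2 p) (polyL2 (diskOp p)) := by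
  induction m generalizing p with
  | zero =>
    have : polyL2 p = 0 := inner_self_eq_zero.1 (ho _ (polyL2_mem_polySpace hp))
    simp [this]
  | succ m ih =>
    obtain ⟨q, hq, hqp⟩ := (polySpace (N + m)).starProjection_apply_mem (polyL2 p)
    have hr : polyL2 (p - q) ∈ (polySpace (N + m))ᗮ := by
      rw [map_sub, hqp]
      exact Submodule.sub_starProjection_mem_orthogonal _
    have hle : polySpace N ≤ polySpace (N + m) := polySpace_mono (by omega)
    have hqo : polyL2 q ∈ (polySpace N)ᗮ := by
      have := Submodule.sub_mem _ ho (Submodule.orthogonal_le hle hr)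
      rwa [map_sub, sub_sub_cancel] at this
    have hrd : p - q ∈ restrictTotalDegree (Fin 2) ℝ (N + m + 1) :=
      Submodule.sub_mem _ hp (restrictTotalDegree_mono (by omega) hq)
    have e := polyL2_diskOp_of_orthogonal hrd hr
    have hpq : p = q + (p - q) := by abel
    have o1 : inner ℝ (polyL2 q) (polyL2 (p - q)) = 0 := hr _ (polyL2_mem_polySpace hq)
    have o2 : inner ℝ (polyL2 (p - q)) (polyL2 (diskOp q)) = 0 := by
      rw [real_inner_comm]
      exact hr _ (polyL2_mem_polySpace (diskOp_mem hq))
    have h1 := ih hq hqo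
    rw [hpq, map_add, map_add, map_add, norm_add_sq_real, inner_add_left, inner_add_right,
      inner_add_right, o1, o2, e, real_inner_smul_right, real_inner_smul_right, o1,
      real_inner_self_eq_norm_sq]
    have h2 : ((N : ℝ) + 1) * (N + 3) ≤ (((N + m : ℕ) : ℝ) + 1) * ((N + m : ℕ) + 3) := by
      push_cast
      have : (0 : ℝ) ≤ m := Nat.cast_nonneg m
      gcongr <;> linarith
    have h3 := mul_le_mul_of_nonneg_right h2 (sq_nonneg ‖polyL2 (p - q)‖)
    linarith

theorem norm_sub_starProjection_le {E : Type*} [NormedAddCommGroup E] [InnerProductSpace ℝ E]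
    {K : Submodule ℝ E} [K.HasOrthogonalProjection] (u : E) {v : E} (hv : v ∈ K) :
    ‖u - K.starProjection u‖ ≤ ‖u - v‖ := by
  have h : u - K.starProjection u = Kᗮ.starProjection (u - v) := by
    rw [Submodule.starProjection_orthogonal_val, map_sub, Submodule.starProjection_eq_self_iff.2 hv]
    abel
  rw [h]
  simpa using ContinuousLinearMap.le_of_opNorm_le _ (Kᗮ.starProjection_norm_le) (u - v)

/-- **Poincaré inequality** on the unit disk, on the complement of the polynomials of degree at
most `N`. -/
theorem poincare_unitDisk (N : ℕ) {u : L2Scalar unitDisk} {G : L2Field unitDisk}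
    (hG : IsWeakGradient unitDisk u G) (hu : u ∈ (polySpace N)ᗮ) :
    ((N : ℝ) + 1) * (N + 3) * ‖u‖ ^ 2 ≤ ‖G‖ ^ 2 := by
  -- Let `q` be the projection of `u` and `Q = -⟪q, L q⟫`. Since `L q` keeps the degree bound, `Q =
  -- -⟪u, L q⟫ = ⟪G, A∇q⟫ ≤ ‖G‖ √Q`, so `Q ≤ ‖G‖²`. The gradient of `q` is never compared with `G`
  -- directly.
  have key : ∀ M, N ≤ M →
      ((N : ℝ) + 1) * (N + 3) * ‖(polySpace M).starProjection u‖ ^ 2 ≤ ‖G‖ ^ 2 := by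
    intro M hM
    obtain ⟨q, hq, hqu⟩ := (polySpace M).starProjection_apply_mem u
    have hr : u - polyL2 q ∈ (polySpace M)ᗮ := by
      rw [hqu]
      exact Submodule.sub_starProjection_mem_orthogonal _
    have hqo : polyL2 q ∈ (polySpace N)ᗮ := by
      have := Submodule.sub_mem _ hu (Submodule.orthogonal_le (polySpace_mono hM) hr)
      rwa [sub_sub_cancel] at this
    obtain ⟨m, rfl⟩ := Nat.exists_eq_add_of_le hM
    have h1 := diskOp_coercive N m hq hqo
    have h2 : inner ℝ u (polyL2 (diskOp q)) = inner ℝ (polyL2 q) (polyL2 (diskOp q)) := by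
      have := hr _ (polyL2_mem_polySpace (diskOp_mem hq))
      rw [real_inner_comm, inner_sub_left] at this
      linarith
    have h3 := norm_sq_polyField_diskField_le q
    have h4 := inner_polyField_diskField hG q
    have h5 := real_inner_le_norm G (polyField (diskField q))
    rw [← hqu]
    rw [h4, h2] at h5
    nlinarith [norm_nonneg G, norm_nonneg (polyField (diskField q)),
      sq_nonneg (‖G‖ - ‖polyField (diskField q)‖)]
  have hlim : ∀ ε > 0, √(((N : ℝ) + 1) * (N + 3)) * (‖u‖ - ε) ≤ ‖G‖ := by
    intro ε hε
    obtain ⟨p, hp⟩ := exists_polyL2_near u hε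
    have h1 := norm_sub_starProjection_le u (polyL2_mem_polySpace
      ((mem_restrictTotalDegree _ _ _).2 (le_max_right N p.totalDegree)))
    have h2 := norm_sub_norm_le u
      (u - (polySpace (max N p.totalDegree)).starProjection u)
    rw [sub_sub_cancel] at h2
    refine le_trans ?_ (Real.sqrt_le_sqrt (key _ (le_max_left N p.totalDegree)) |>.trans_eq
      (Real.sqrt_sq (norm_nonneg _)))
    rw [Real.sqrt_mul (by positivity : (0 : ℝ) ≤ (N + 1) * (N + 3)) (‖_‖ ^ 2),
      Real.sqrt_sq (norm_nonneg _)]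
    gcongr
    linarith
  have h0 : √(((N : ℝ) + 1) * (N + 3)) * ‖u‖ ≤ ‖G‖ := by
    have hpos : 0 < √(((N : ℝ) + 1) * (N + 3)) := by positivity
    rw [← le_div_iff₀' hpos]
    refine le_of_forall_pos_le_add fun δ hδ => ?_
    have := hlim δ hδ
    rw [← le_div_iff₀' hpos] at this
    linarith
  have h1 := pow_le_pow_left₀ (by positivity) h0 2
  rwa [mul_pow, Real.sq_sqrt (by positivity)] at h1

end DiskOperator

/-! ### Affine changes of variables in `L²` and for weak gradients. -/

section Pullback

variable {F : Type*} [NormedAddCommGroup F]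

theorem memLp_comp_homeomorph {Φ : Plane ≃ₜ Plane} {μ ν : Measure Plane} {k : ENNReal}
    (hk : k ≠ ⊤) (h : ν.map Φ = k • μ) (u : Lp F 2 μ) : MemLp (u ∘ Φ) 2 ν := by
  refine MemLp.comp_of_map ?_ Φ.measurable.aemeasurable
  rw [h]
  exact (Lp.memLp u).smul_measure hk

variable [InnerProductSpace ℝ F]

theorem ae_comp_homeomorph {Φ : Plane ≃ₜ Plane} {μ ν : Measure Plane} {k : ENNReal}
    (h : ν.map Φ = k • μ) {p : Plane → Prop} (hp : ∀ᵐ x ∂μ, p x) : ∀ᵐ x ∂ν, p (Φ x) := by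
  refine ae_of_ae_map Φ.measurable.aemeasurable ?_
  rw [h]
  exact Measure.ae_smul_measure hp k

theorem integral_comp_homeomorph {Φ : Plane ≃ₜ Plane} {μ ν : Measure Plane} {k : ENNReal}
    (h : ν.map Φ = k • μ) (f : Plane → ℝ) : ∫ x, f (Φ x) ∂ν = k.toReal * ∫ x, f x ∂μ := by
  rw [← Φ.measurableEmbedding.integral_map, h, integral_smul_measure, smul_eq_mul]

/-- Composition with a homeomorphism that preserves measure up to a constant, on `L²`. -/
noncomputable def compL2 {Φ : Plane ≃ₜ Plane} {μ ν : Measure Plane} {k : ENNReal}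
    (hk : k ≠ ⊤) (h : ν.map Φ = k • μ) : Lp F 2 μ →ₗ[ℝ] Lp F 2 ν where
  toFun u := (memLp_comp_homeomorph hk h u).toLp _
  map_add' u v := by
    rw [← MemLp.toLp_add]
    refine MemLp.toLp_congr _ _ ?_
    filter_upwards [ae_comp_homeomorph h (Lp.coeFn_add u v)] with x hx
    simpa using hx
  map_smul' c u := by
    rw [RingHom.id_apply, ← MemLp.toLp_const_smul]
    refine MemLp.toLp_congr _ _ ?_
    filter_upwards [ae_comp_homeomorph h (Lp.coeFn_smul c u)] with x hx
    simpa using hx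

theorem coeFn_compL2 {Φ : Plane ≃ₜ Plane} {μ ν : Measure Plane} {k : ENNReal}
    (hk : k ≠ ⊤) (h : ν.map Φ = k • μ) (u : Lp F 2 μ) :
    compL2 hk h u =ᵐ[ν] u ∘ Φ :=
  MemLp.coeFn_toLp (memLp_comp_homeomorph hk h u)

theorem inner_compL2 {Φ : Plane ≃ₜ Plane} {μ ν : Measure Plane} {k : ENNReal}
    (hk : k ≠ ⊤) (h : ν.map Φ = k • μ) (u v : Lp F 2 μ) :
    inner ℝ (compL2 hk h u) (compL2 hk h v) = k.toReal * inner ℝ u v := by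
  rw [L2.inner_def, L2.inner_def, ← integral_comp_homeomorph h]
  refine integral_congr_ae ?_
  filter_upwards [coeFn_compL2 hk h u, coeFn_compL2 hk h v] with x h1 h2
  rw [h1, h2]
  rfl

theorem map_symm_homeomorph {Φ : Plane ≃ₜ Plane} {μ ν : Measure Plane} {k : ENNReal}
    (hk0 : k ≠ 0) (hk : k ≠ ⊤) (h : ν.map Φ = k • μ) : μ.map Φ.symm = k⁻¹ • ν := by
  have h1 : (k • μ).map Φ.symm = ν := by
    rw [← h, Measure.map_map Φ.symm.measurable Φ.measurable, Φ.symm_comp_self, Measure.map_id]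
  rw [← h1, Measure.map_smul, smul_smul, ENNReal.inv_mul_cancel hk0 hk, one_smul]

theorem compL2_surjective {Φ : Plane ≃ₜ Plane} {μ ν : Measure Plane} {k : ENNReal}
    (hk0 : k ≠ 0) (hk : k ≠ ⊤) (h : ν.map Φ = k • μ) :
    Function.Surjective (compL2 (F := F) hk h) := by
  intro v
  have h' := map_symm_homeomorph hk0 hk h
  refine ⟨compL2 (ENNReal.inv_ne_top.2 hk0) h' v, Lp.ext ?_⟩
  filter_upwards [coeFn_compL2 hk h (compL2 (ENNReal.inv_ne_top.2 hk0) h' v),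
    ae_comp_homeomorph h (coeFn_compL2 (ENNReal.inv_ne_top.2 hk0) h' v)] with x h1 h2
  rw [h1, Function.comp_apply, h2, Function.comp_apply, Homeomorph.symm_apply_apply]

theorem compL2_injective {Φ : Plane ≃ₜ Plane} {μ ν : Measure Plane} {k : ENNReal}
    (hk0 : k ≠ 0) (hk : k ≠ ⊤) (h : ν.map Φ = k • μ) :
    Function.Injective (compL2 (F := F) hk h) := by
  rw [← LinearMap.ker_eq_bot, LinearMap.ker_eq_bot']
  intro u hu
  have h1 := inner_compL2 hk h u u
  rw [hu, inner_zero_left] at h1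
  refine inner_self_eq_zero (𝕜 := ℝ).1 ((mul_eq_zero.1 h1.symm).resolve_left ?_)
  exact (ENNReal.toReal_pos hk0 hk).ne'

/-- The affine homeomorphism `z ↦ c + M z`. -/
noncomputable def affineHomeo (c : Plane) (M : Plane ≃L[ℝ] Plane) : Plane ≃ₜ Plane :=
  M.toHomeomorph.trans (Homeomorph.addLeft c)

theorem affineHomeo_apply (c : Plane) (M : Plane ≃L[ℝ] Plane) (z : Plane) :
    affineHomeo c M z = c + M z := rfl

theorem exists_map_affineHomeo (c : Plane) (M : Plane ≃L[ℝ] Plane) (E : Set Plane) :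
    ∃ k : ENNReal, k ≠ 0 ∧ k ≠ ⊤ ∧
      (volume.restrict (affineHomeo c M ⁻¹' E)).map (affineHomeo c M)
        = k • volume.restrict E := by
  have hdet : LinearMap.det (M : Plane →ₗ[ℝ] Plane) ≠ 0 :=
    (LinearEquiv.isUnit_det' M.toLinearEquiv).ne_zero
  refine ⟨ENNReal.ofReal |(LinearMap.det (M : Plane →ₗ[ℝ] Plane))⁻¹|, ?_, ENNReal.ofReal_ne_top, ?_⟩
  · simpa using hdet
  · have h1 : (volume : Measure Plane).map (affineHomeo c M)
        = ENNReal.ofReal |(LinearMap.det (M : Plane →ₗ[ℝ] Plane))⁻¹| • volume := by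
      have e : (affineHomeo c M : Plane → Plane) = (fun x => c + x) ∘ (M : Plane →ₗ[ℝ] Plane) := rfl
      rw [e, ← Measure.map_map (measurable_const_add c)
        (LinearMap.continuous_of_finiteDimensional _).measurable,
        Measure.map_linearMap_addHaar_eq_smul_addHaar _ hdet, Measure.map_smul,
        map_add_left_eq_self]
    rw [← (affineHomeo c M).measurableEmbedding.restrict_map, h1, Measure.restrict_smul]

/-- Chain rule: `hG'` says `G' = Mᵀ (G ∘ Φ)`. Test functions correspond under `Φ`, directions under
`M`, and the Jacobian factor `k` appears on both sides. -/
theorem isWeakGradient_affine_iff {c : Plane} {M : Plane ≃L[ℝ] Plane} {E D : Set Plane}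
    (hD : affineHomeo c M ⁻¹' E = D) {k : ENNReal} (hk0 : k ≠ 0) (hk : k ≠ ⊤)
    (h : (volume.restrict D).map (affineHomeo c M) = k • volume.restrict E)
    (u : L2Scalar E) (G : L2Field E) (G' : L2Field D)
    (hG' : ∀ᵐ x ∂(volume.restrict D), ∀ w, inner ℝ (G' x) w = inner ℝ (G (affineHomeo c M x)) (M w)) :
    IsWeakGradient E u G ↔ IsWeakGradient D (compL2 hk h u) G' := by
  have hkr : k.toReal ≠ 0 := (ENNReal.toReal_pos hk0 hk).ne'
  have key1 : ∀ ψ : Plane → ℝ, ContDiff ℝ ∞ ψ → ∀ w,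
      ∫ x in D, compL2 hk h u x * fderiv ℝ (ψ ∘ affineHomeo c M) x w
        = k.toReal * ∫ x in E, u x * fderiv ℝ ψ x (M w) := by
    intro ψ hψ w
    rw [← integral_comp_homeomorph h]
    refine integral_congr_ae ?_
    filter_upwards [coeFn_compL2 hk h u] with x hx
    have h1 : HasFDerivAt (affineHomeo c M) (M : Plane →L[ℝ] Plane) x :=
      (M : Plane →L[ℝ] Plane).hasFDerivAt.const_add c
    have h2 := ((hψ.differentiable (by simp) (affineHomeo c M x)).hasFDerivAt.comp x h1).fderiv
    rw [hx, h2]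
    rfl
  have key2 : ∀ (ψ : Plane → ℝ) w,
      ∫ x in D, inner ℝ (G' x) w * (ψ ∘ affineHomeo c M) x
        = k.toReal * ∫ x in E, inner ℝ (G x) (M w) * ψ x := by
    intro ψ w
    rw [← integral_comp_homeomorph h]
    refine integral_congr_ae ?_
    filter_upwards [hG'] with x hx
    rw [hx]
    rfl
  have hΦ : ContDiff ℝ ∞ (affineHomeo c M) := contDiff_const.add M.contDiff
  have hΦs : ContDiff ℝ ∞ (affineHomeo c M).symm := M.symm.contDiff.comp
    (contDiff_const.add contDiff_id)
  constructor
  · intro hu φ hφ hc hs w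
    have e : φ = (φ ∘ (affineHomeo c M).symm) ∘ affineHomeo c M := by
      ext x
      simp
    have hψ : ContDiff ℝ ∞ (φ ∘ (affineHomeo c M).symm) := hφ.comp hΦs
    rw [e, key1 _ hψ, key2]
    rw [hu _ hψ (hc.comp_homeomorph _) ?_ (M w), mul_neg]
    rw [tsupport_comp_eq_preimage]
    intro x hx
    have h1 := hs hx
    rw [← hD] at h1
    simpa using h1
  · intro hu ψ hψ hc hs w
    have h1 := hu _ (hψ.comp hΦ) (hc.comp_homeomorph _) (by
      rw [tsupport_comp_eq_preimage, ← hD]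
      exact Set.preimage_mono hs) (M.symm w)
    rw [key1 _ hψ, key2, M.apply_symm_apply, ← mul_neg] at h1
    exact mul_left_cancel₀ hkr h1

end Pullback

/-! ### Transplanting an ellipse to the unit disk. -/

section Ellipse

/-- The diagonal map `(x, y) ↦ (a x, b y)`. -/
noncomputable def diagMap (a b : ℝ) : Plane →L[ℝ] Plane :=
  LinearMap.toContinuousLinearMap
    { toFun := fun x => !₂[a * x 0, b * x 1]
      map_add' := fun x y => by ext i; fin_cases i <;> simp [mul_add]
      map_smul' := fun c x => by ext i; fin_cases i <;> simp [mul_left_comm] }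

@[simp] theorem diagMap_apply_zero (a b : ℝ) (x : Plane) : diagMap a b x 0 = a * x 0 := rfl

@[simp] theorem diagMap_apply_one (a b : ℝ) (x : Plane) : diagMap a b x 1 = b * x 1 := rfl

theorem diagMap_diagMap (a b a' b' : ℝ) (x : Plane) :
    diagMap a b (diagMap a' b' x) = diagMap (a * a') (b * b') x := by
  ext i
  fin_cases i <;> simp [mul_assoc]

@[simp] theorem diagMap_one_one (x : Plane) : diagMap 1 1 x = x := by
  ext i
  fin_cases i <;> simp

theorem inner_diagMap (a b : ℝ) (x y : Plane) :
    inner ℝ (diagMap a b x) y = inner ℝ x (diagMap a b y) := by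
  simp only [PiLp.inner_apply, Fin.sum_univ_two, diagMap_apply_zero, diagMap_apply_one,
    RCLike.inner_apply, conj_trivial]
  ring

/-- `diagMap a b` as an equivalence. -/
noncomputable def diagEquiv {a b : ℝ} (ha : a ≠ 0) (hb : b ≠ 0) : Plane ≃L[ℝ] Plane :=
  ContinuousLinearEquiv.equivOfInverse (diagMap a b) (diagMap a⁻¹ b⁻¹)
    (fun x => by simp [diagMap_diagMap, ha, hb]) (fun x => by simp [diagMap_diagMap, ha, hb])

/-- The action of `diagMap 1 τ` on `L²` fields of the unit disk. -/
noncomputable def stretch (τ : ℝ) : L2Field unitDisk →L[ℝ] L2Field unitDisk :=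
  (diagMap 1 τ).compLpL 2 (volume.restrict unitDisk)

theorem coeFn_stretch (τ : ℝ) (G : L2Field unitDisk) :
    stretch τ G =ᵐ[volume.restrict unitDisk] fun x => diagMap 1 τ (G x) :=
  ContinuousLinearMap.coeFn_compLpL _ _

theorem stretch_stretch (τ σ : ℝ) (G : L2Field unitDisk) :
    stretch τ (stretch σ G) = stretch (τ * σ) G := by
  refine Lp.ext ?_
  filter_upwards [coeFn_stretch τ (stretch σ G), coeFn_stretch σ G, coeFn_stretch (τ * σ) G]
    with x h1 h2 h3
  rw [h1, h2, h3, diagMap_diagMap, one_mul]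

theorem stretch_one (G : L2Field unitDisk) : stretch 1 G = G := by
  refine Lp.ext ?_
  filter_upwards [coeFn_stretch 1 G] with x h1
  rw [h1, diagMap_one_one]

/-- The pairs `(u, S ∇u)`, with `S = diag (1, τ)`, on the unit disk. -/
noncomputable def stretchedGraph (τ : ℝ) :
    Submodule ℝ (WithLp 2 (L2Scalar unitDisk × L2Field unitDisk)) :=
  (sobolevGraph unitDisk).comap
    (((WithLp.prodContinuousLinearEquiv 2 ℝ (L2Scalar unitDisk) (L2Field unitDisk)).symm :
        _ →L[ℝ] _) ∘L
      ((WithLp.fstL 2 ℝ _ _).prod (stretch τ⁻¹ ∘L WithLp.sndL 2 ℝ _ _)) :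
        WithLp 2 (L2Scalar unitDisk × L2Field unitDisk) →L[ℝ]
          WithLp 2 (L2Scalar unitDisk × L2Field unitDisk)).toLinearMap

theorem mem_stretchedGraph {τ : ℝ} {x : WithLp 2 (L2Scalar unitDisk × L2Field unitDisk)} :
    x ∈ stretchedGraph τ ↔ IsWeakGradient unitDisk x.fst (stretch τ⁻¹ x.snd) := Iff.rfl

theorem isClosed_stretchedGraph (τ : ℝ) :
    IsClosed (stretchedGraph τ : Set (WithLp 2 (L2Scalar unitDisk × L2Field unitDisk))) :=
  (isClosed_sobolevGraph unitDisk).preimage (ContinuousLinearMap.continuous _)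

instance (τ : ℝ) : CompleteSpace (stretchedGraph τ) :=
  (isClosed_stretchedGraph τ).completeSpace_coe

/-- The function component. -/
noncomputable def graphFst (τ : ℝ) : stretchedGraph τ →L[ℝ] L2Scalar unitDisk :=
  WithLp.fstL 2 ℝ _ _ ∘L (stretchedGraph τ).subtypeL

/-- The stretched gradient component. -/
noncomputable def graphSnd (τ : ℝ) : stretchedGraph τ →L[ℝ] L2Field unitDisk :=
  WithLp.sndL 2 ℝ _ _ ∘L (stretchedGraph τ).subtypeL

/-- Storing `S∇u` instead of `∇u` makes the energy the plain norm of the second component, so the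
ambient inner product is the graph inner product for every `τ`. -/
theorem isGraphInner (τ : ℝ) : IsGraphInner (graphFst τ) (graphSnd τ) := fun w z =>
  WithLp.prod_inner_apply (w : WithLp 2 (L2Scalar unitDisk × L2Field unitDisk)) z

theorem isWeakGradient_graph {τ : ℝ} (w : stretchedGraph τ) :
    IsWeakGradient unitDisk (graphFst τ w) (stretch τ⁻¹ (graphSnd τ w)) := w.2

/-- The element of the graph given by a weak gradient. -/
noncomputable def graphMk {τ : ℝ} (hτ : τ ≠ 0) {u : L2Scalar unitDisk} {G : L2Field unitDisk}
    (h : IsWeakGradient unitDisk u G) : stretchedGraph τ :=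
  ⟨WithLp.toLp 2 (u, stretch τ G), by
    rw [mem_stretchedGraph]
    simpa [stretch_stretch, hτ, stretch_one] using h⟩

@[simp] theorem graphFst_graphMk {τ : ℝ} (hτ : τ ≠ 0) {u : L2Scalar unitDisk}
    {G : L2Field unitDisk} (h : IsWeakGradient unitDisk u G) : graphFst τ (graphMk hτ h) = u := rfl

@[simp] theorem graphSnd_graphMk {τ : ℝ} (hτ : τ ≠ 0) {u : L2Scalar unitDisk}
    {G : L2Field unitDisk} (h : IsWeakGradient unitDisk u G) :
    graphSnd τ (graphMk hτ h) = stretch τ G := rfl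

/-- The source of all monotonicity in `τ`: applied to `S∇u` it says `‖∇u‖ ≤ ‖S∇u‖`. -/
theorem norm_le_norm_stretch {τ : ℝ} (hτ : 1 ≤ τ) (G : L2Field unitDisk) :
    ‖stretch τ⁻¹ G‖ ≤ ‖G‖ := by
  refine Lp.norm_le_norm_of_ae_le ?_
  filter_upwards [coeFn_stretch τ⁻¹ G] with x hx
  rw [hx, EuclideanSpace.norm_eq, EuclideanSpace.norm_eq]
  refine Real.sqrt_le_sqrt ?_
  simp only [Fin.sum_univ_two, diagMap_apply_zero, diagMap_apply_one, Real.norm_eq_abs, sq_abs,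
    one_mul, mul_pow]
  have : (τ⁻¹) ^ 2 ≤ 1 := pow_le_one₀ (by positivity) (inv_le_one_of_one_le₀ hτ)
  nlinarith [sq_nonneg (G x 1)]

theorem hasDivergentRayleigh {τ : ℝ} (hτ : 1 ≤ τ) :
    HasDivergentRayleigh (graphFst τ) (graphSnd τ) := by
  intro C
  obtain ⟨N, hN⟩ := exists_nat_gt C
  refine ⟨polySpace N, inferInstance, fun w hw => ?_⟩
  have h1 := poincare_unitDisk N (isWeakGradient_graph w) hw
  have h2 := pow_le_pow_left₀ (norm_nonneg _) (norm_le_norm_stretch hτ (graphSnd τ w)) 2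
  have h3 : C ≤ ((N : ℝ) + 1) * (N + 3) := by nlinarith [(Nat.cast_nonneg N : (0 : ℝ) ≤ N)]
  exact (mul_le_mul_of_nonneg_right h3 (sq_nonneg _)).trans (h1.trans h2)

theorem exists_linearIndependent_graphFst {τ : ℝ} (hτ : τ ≠ 0) (j : ℕ) :
    ∃ w : Fin j → stretchedGraph τ, LinearIndependent ℝ (fun i => graphFst τ (w i)) := by
  refine ⟨fun i => graphMk hτ (isWeakGradient_polyL2
    (MvPolynomial.monomial (Finsupp.single 0 (i : ℕ)) 1)), ?_⟩
  have h := (MvPolynomial.basisMonomials (Fin 2) ℝ).linearIndependent.comp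
    (fun i : Fin j => Finsupp.single 0 (i : ℕ))
    (fun i k h => Fin.ext (Finsupp.single_injective _ h))
  have h2 := h.map' polyL2 (LinearMap.ker_eq_bot.2 polyL2_injective)
  simpa [Function.comp_def] using h2

/-- The `j`-th eigenvalue level set of the form on the unit disk. -/
def diskLevels (τ : ℝ) (j : ℕ) : Set ℝ := formLevels (graphFst τ) (graphSnd τ) j

/-- The pullback of `u` has gradient `diag (a, b)` applied to `∇u` in the basis `e`, so its
stretched gradient is `a` times `∇u` in that basis. Energies thus scale by `a² k` and masses by `k`,
and eigenvalues by `a²`. -/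
theorem neumannLevels_ellipse {c : Plane} {e : OrthonormalBasis (Fin 2) ℝ Plane} {a b : ℝ}
    (ha : 0 < a) (hb : 0 < b) (j : ℕ) :
    neumannLevels {p : Plane | (inner ℝ (e 0) (p - c) / a) ^ 2 + (inner ℝ (e 1) (p - c) / b) ^ 2 < 1}
      j = {t | a ^ 2 * t ∈ diskLevels (a / b) j} := by
  set E : Set Plane :=
    {p : Plane | (inner ℝ (e 0) (p - c) / a) ^ 2 + (inner ℝ (e 1) (p - c) / b) ^ 2 < 1}
  have hτ : a / b ≠ 0 := by positivity
  let M : Plane ≃L[ℝ] Plane :=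
    (diagEquiv ha.ne' hb.ne').trans e.repr.symm.toContinuousLinearEquiv
  have hM : ∀ z, M z = e.repr.symm (diagMap a b z) := fun _ => rfl
  have hD : affineHomeo c M ⁻¹' E = unitDisk := by
    ext z
    rw [mem_ball_zero_iff, EuclideanSpace.norm_eq, Real.sqrt_lt' one_pos, Set.mem_preimage,
      Set.mem_ofPred_eq, affineHomeo_apply, add_sub_cancel_left, ← e.repr_apply_apply,
      ← e.repr_apply_apply, hM, LinearIsometryEquiv.apply_symm_apply]
    simp [Fin.sum_univ_two, ha.ne', hb.ne']
  obtain ⟨k, hk0, hk, h⟩ := exists_map_affineHomeo c M E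
  rw [hD] at h
  let T : L2Scalar E →ₗ[ℝ] L2Scalar unitDisk := compL2 hk h
  let T₂ : L2Field E → L2Field unitDisk := fun G =>
    a • (e.repr : Plane →L[ℝ] Plane).compLpL 2 (volume.restrict unitDisk) (compL2 hk h G)
  have hT₂ : ∀ G, T₂ G =ᵐ[volume.restrict unitDisk] fun x => a • e.repr (G (affineHomeo c M x)) := by
    intro G
    filter_upwards [Lp.coeFn_smul a ((e.repr : Plane →L[ℝ] Plane).compLpL 2
        (volume.restrict unitDisk) (compL2 hk h G)),
      ContinuousLinearMap.coeFn_compLpL (e.repr : Plane →L[ℝ] Plane) (compL2 hk h G),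
      coeFn_compL2 hk h G] with x h1 h2 h3
    rw [h1, Pi.smul_apply, h2, h3]
    rfl
  have hinner₁ : ∀ u v, inner ℝ (T u) (T v) = k.toReal * inner ℝ u v := inner_compL2 hk h
  have hinner₂ : ∀ G H, inner ℝ (T₂ G) (T₂ H) = a ^ 2 * (k.toReal * inner ℝ G H) := by
    intro G H
    rw [L2.inner_def, L2.inner_def, ← integral_comp_homeomorph h, ← integral_const_mul]
    refine integral_congr_ae ?_
    filter_upwards [hT₂ G, hT₂ H] with x h1 h2
    rw [h1, h2, real_inner_smul_left, real_inner_smul_right, LinearIsometryEquiv.inner_map_map]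
    ring
  have hT₂s : Function.Surjective T₂ := by
    intro G
    obtain ⟨G', hG'⟩ := compL2_surjective hk0 hk h (a⁻¹ •
      (e.repr.symm : Plane →L[ℝ] Plane).compLpL 2 (volume.restrict unitDisk) G)
    refine ⟨G', Lp.ext ?_⟩
    filter_upwards [hT₂ G', coeFn_compL2 hk h G', Lp.coeFn_smul a⁻¹
      ((e.repr.symm : Plane →L[ℝ] Plane).compLpL 2 (volume.restrict unitDisk) G),
      ContinuousLinearMap.coeFn_compLpL (e.repr.symm : Plane →L[ℝ] Plane) G] with x h1 h2 h3 h4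
    rw [Function.comp_apply] at h2
    rw [h1, ← h2, hG', h3, Pi.smul_apply, h4]
    simp [ha.ne']
  have hweak : ∀ u G, IsWeakGradient E u G ↔
      IsWeakGradient unitDisk (T u) (stretch (a / b)⁻¹ (T₂ G)) := by
    intro u G
    refine isWeakGradient_affine_iff hD hk0 hk h u G _ ?_
    filter_upwards [coeFn_stretch (a / b)⁻¹ (T₂ G), hT₂ G] with x h1 h2 w
    have h3 : diagMap 1 (a / b)⁻¹ (a • e.repr (G (affineHomeo c M x)))
        = diagMap a b (e.repr (G (affineHomeo c M x))) := by
      ext i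
      fin_cases i
      · simp
      · simp
        field_simp
    rw [h1, h2, h3, hM, inner_diagMap, ← e.repr.inner_map_map (G (affineHomeo c M x)),
      LinearIsometryEquiv.apply_symm_apply]
  have heig : ∀ κ u, IsNeumannEigenfunction E κ u ↔
      IsFormEigenvector (graphFst (a / b)) (graphSnd (a / b)) (a ^ 2 * κ) (T u) := by
    intro κ u
    have hT0 : u ≠ 0 ↔ T u ≠ 0 := by
      rw [Ne, Ne, not_iff_not]
      exact (map_eq_zero_iff T (compL2_injective hk0 hk h)).symm
    have hkr : k.toReal ≠ 0 := (ENNReal.toReal_pos hk0 hk).ne'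
    refine and_congr hT0 ⟨?_, ?_⟩
    · rintro ⟨G, hG, he⟩
      refine ⟨⟨WithLp.toLp 2 (T u, T₂ G), (hweak u G).1 hG⟩, rfl, fun z => ?_⟩
      obtain ⟨v, hv⟩ := compL2_surjective hk0 hk h (graphFst (a / b) z)
      obtain ⟨H, hH⟩ := hT₂s (graphSnd (a / b) z)
      have hvH : IsWeakGradient E v H := by
        rw [hweak, hH]
        change IsWeakGradient unitDisk (compL2 hk h v) _
        rw [hv]
        exact isWeakGradient_graph z
      change inner ℝ (T₂ G) (graphSnd (a / b) z) = a ^ 2 * κ * inner ℝ (T u) (graphFst (a / b) z)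
      rw [← hv, ← hH, hinner₂, he v H hvH]
      change _ = _ * inner ℝ (T u) (T v)
      rw [hinner₁]
      ring
    · rintro ⟨w, hw, he⟩
      obtain ⟨G, hG⟩ := hT₂s (graphSnd (a / b) w)
      refine ⟨G, ?_, fun v H hvH => ?_⟩
      · rw [hweak, hG, ← hw]
        exact isWeakGradient_graph w
      · have h1 := he ⟨WithLp.toLp 2 (T v, T₂ H), (hweak v H).1 hvH⟩
        change inner ℝ (graphSnd (a / b) w) (T₂ H) = a ^ 2 * κ * inner ℝ (graphFst (a / b) w) (T v)
          at h1
        rw [← hG, hw, hinner₂, hinner₁] at h1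
        have : a ^ 2 * k.toReal ≠ 0 := mul_ne_zero (by positivity) hkr
        refine mul_left_cancel₀ this ?_
        linear_combination h1
  ext t
  constructor
  · rintro ⟨u, hu, hκ⟩
    refine ⟨fun i => T (u i), hu.map' T (LinearMap.ker_eq_bot.2 (compL2_injective hk0 hk h)),
      fun i => ?_⟩
    obtain ⟨κ, hκt, hκ⟩ := hκ i
    exact ⟨a ^ 2 * κ, by gcongr, (heig _ _).1 hκ⟩
  · rintro ⟨u, hu, hκ⟩
    choose u' hu' using fun i => compL2_surjective (F := ℝ) hk0 hk h (u i)
    refine ⟨u', LinearIndependent.of_comp T ?_, fun i => ?_⟩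
    · have : T ∘ u' = u := funext hu'
      rwa [this]
    · obtain ⟨κ, hκt, hκ⟩ := hκ i
      refine ⟨κ / a ^ 2, by rw [div_le_iff₀ (by positivity)]; linarith, (heig _ _).2 ?_⟩
      rw [mul_div_cancel₀ _ (by positivity)]
      change IsFormEigenvector _ _ κ (compL2 hk h (u' i))
      rwa [hu']

end Ellipse

/-! ### Disk eigenfunctions depending on one coordinate vanish. -/

section OneVariableEigenfunctions

open MvPolynomial

theorem ae_coord_ne_zero (i : Fin 2) : ∀ᵐ x ∂(volume : Measure Plane), x i ≠ 0 := by
  have h : (EuclideanSpace.proj i : Plane →L[ℝ] ℝ).ker ≠ ⊤ := by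
    intro h
    have h1 : EuclideanSpace.single i (1 : ℝ) ∈ (EuclideanSpace.proj i : Plane →L[ℝ] ℝ).ker := by
      rw [h]; trivial
    simp at h1
  have h2 := Measure.addHaar_submodule (volume : Measure Plane) _ h
  rw [ae_iff]
  convert h2 using 2
  ext x
  simp

/-- The line `x = 0` is null, so dividing by `x⁴` is harmless. The moment identity below reaches
only powers of `x` from the fourth on. -/
theorem eq_zero_of_forall_inner_mul {u : L2Scalar unitDisk}
    (h : ∀ p, inner ℝ u (polyL2 (X 0 ^ 4 * p)) = 0) : u = 0 := by
  have hv : MemLp (fun x : Plane => x 0 ^ 4 * u x) 2 (volume.restrict unitDisk) := by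
    refine (Lp.memLp u).of_le ?_ ?_
    · exact (Continuous.aestronglyMeasurable (by fun_prop)).mul (Lp.aestronglyMeasurable u)
    · filter_upwards [ae_restrict_mem measurableSet_ball] with x hx
      rw [mem_ball_zero_iff] at hx
      have : ‖x 0‖ ≤ 1 := (PiLp.norm_apply_le x 0).trans hx.le
      rw [norm_mul, norm_pow]
      exact mul_le_of_le_one_left (norm_nonneg _) (pow_le_one₀ (norm_nonneg _) this)
  have hv0 : hv.toLp _ = 0 := by
    refine eq_zero_of_forall_inner_polyL2 fun p => ?_
    rw [inner_polyL2, ← h p, inner_polyL2]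
    refine integral_congr_ae ?_
    filter_upwards [hv.coeFn_toLp] with x hx
    rw [hx]
    simp
    ring
  rw [Lp.eq_zero_iff_ae_eq_zero] at hv0 ⊢
  filter_upwards [hv0, hv.coeFn_toLp, ae_restrict_of_ae (ae_coord_ne_zero 0)] with x h1 h2 h3
  rw [h1, Pi.zero_apply] at h2
  exact (mul_eq_zero.1 h2.symm).resolve_left (pow_ne_zero 4 h3)

/-- A Neumann eigenfunction of the disk with nonzero eigenvalue cannot depend on one coordinate
only. -/
theorem eq_zero_of_eigen_of_snd_eq_zero {u : L2Scalar unitDisk} {G : L2Field unitDisk} {μ : ℝ}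
    (hμ : μ ≠ 0) (hG : IsWeakGradient unitDisk u G)
    (hG1 : ∀ᵐ x ∂(volume.restrict unitDisk), G x 1 = 0)
    (he : ∀ v H, IsWeakGradient unitDisk v H → inner ℝ G H = μ * inner ℝ u v) : u = 0 := by
  let m : MvPolynomial (Fin 2) ℝ →ₗ[ℝ] ℝ := (innerSL ℝ u : _ →ₗ[ℝ] ℝ) ∘ₗ polyL2
  have hm : ∀ p, m p = inner ℝ u (polyL2 p) := fun _ => rfl
  let n : MvPolynomial (Fin 2) ℝ → ℝ := fun p => ∫ x in unitDisk, G x 0 * polyFun p x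
  have hn : ∀ f, inner ℝ G (polyField f) = n (f 0) := by
    intro f
    rw [inner_polyField]
    refine integral_congr_ae ?_
    filter_upwards [hG1] with x hx
    simp [Fin.sum_univ_two, hx]
  have hgrad : ∀ p, n (pderiv 0 p) = μ * m p := fun p => by
    rw [hm, ← he _ _ (isWeakGradient_polyL2 p), hn]
  -- The vertical field `(0, r p)`, with `r = 1 - x² - y²`, is tangent and `G` has no vertical
  -- component. So `m` ignores every `∂/∂y` of a multiple of `r`.
  have hy : ∀ p, m (pderiv 1 (circlePoly * p)) = 0 := by
    intro p
    have h1 := inner_polyField_of_tangent hG (f := ![0, circlePoly * p]) (s := X 1 * p)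
      (by simp; ring)
    rw [hn] at h1
    simpa [n, hm] using h1
  have hx : ∀ p, n (circlePoly * p) = - m (pderiv 0 (circlePoly * p)) := by
    intro p
    have h1 := inner_polyField_of_tangent hG (f := ![circlePoly * p, 0]) (s := X 0 * p)
      (by simp; ring)
    rw [hn] at h1
    simpa [hm] using h1
  have hZ : ∀ C₀ C₁ C₂ Y Z : MvPolynomial (Fin 2) ℝ, pderiv 1 C₀ = 0 → pderiv 1 C₁ = 0 →
      pderiv 1 C₂ = 0 → pderiv 1 Y = 0 → pderiv 1 Z = 0 → pderiv 0 C₀ = C₁ → pderiv 0 C₁ = C₂ →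
      pderiv 0 Y = X 0 * C₀ → pderiv 0 Z = X 0 * Y → m Z = 0 := by
    intro C₀ C₁ C₂ Y Z h1 h2 h3 h4 h5 h6 h7 h8 h9
    let s : MvPolynomial (Fin 2) ℝ := 1 - X 0 * X 0
    let y : MvPolynomial (Fin 2) ℝ := X 1
    let r : MvPolynomial (Fin 2) ℝ := 1 - (X 0 * X 0 + X 1 * X 1)
    -- An antiderivative in `x` of `C₁ ∂/∂y (y r²) = C₁ (s² - 6 s y² + 5 y⁴)`, by repeated
    -- integration by parts. Its `x`-derivative is a multiple of `r`, whose own `x`-derivative is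
    -- again `∂/∂y` of a multiple of `r`; hence `μ m ψ = 0`. Averaging over vertical chords leaves
    -- only `8 Z`.
    let ψ : MvPolynomial (Fin 2) ℝ := (s * s * C₀ + C 4 * s * Y + C 8 * Z)
      - C 6 * (s * C₀ + C 2 * Y) * (y * y) + C 5 * C₀ * (y * y * (y * y))
    have i1 : ψ = C 8 * Z + pderiv 1 (circlePoly *
        (C 2 * y * (s * C₀ + C 2 * Y) - y * y * y * C₀ - y * s * C₀)) := by
      simp only [ψ, s, y, circlePoly, map_sub, map_add, Derivation.leibniz, pderiv_X, pderiv_C,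
        smul_eq_mul, Pi.single_apply, h1, h4, Derivation.map_one_eq_zero]
      simp only [map_ofNat]
      simp
      ring
    have i2 : pderiv 0 ψ = circlePoly * ((r - C 4 * (y * y)) * C₁) := by
      simp only [ψ, s, y, r, circlePoly, map_sub, map_add, Derivation.leibniz, pderiv_X, pderiv_C,
        smul_eq_mul, Pi.single_apply, h6, h8, h9, Derivation.map_one_eq_zero]
      simp only [map_ofNat]
      simp
      ring
    have i3 : pderiv 0 (circlePoly * ((r - C 4 * (y * y)) * C₁)) =
        pderiv 1 (circlePoly * (r * y * C₂ - C 4 * X 0 * y * C₁)) := by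
      simp only [y, r, circlePoly, map_sub, map_add, Derivation.leibniz, pderiv_X, pderiv_C,
        smul_eq_mul, Pi.single_apply, h2, h3, h7, Derivation.map_one_eq_zero]
      simp only [map_ofNat]
      simp
      ring
    have h10 : μ * m ψ = 0 := by rw [← hgrad, i2, hx, i3, hy, neg_zero]
    have h11 : m ψ = 8 * m Z := by
      rw [i1, map_add, hy, add_zero, ← smul_eq_C_mul, map_smul, smul_eq_mul]
    rw [h11] at h10
    simpa [hμ] using h10
  have c2 : (C 2 : MvPolynomial (Fin 2) ℝ) = 2 := map_ofNat C 2
  have c3 : (C 3 : MvPolynomial (Fin 2) ℝ) = 3 := map_ofNat C 3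
  have c4 : (C 4 : MvPolynomial (Fin 2) ℝ) = 4 := map_ofNat C 4
  have hx4 : ∀ k : ℕ, m (X 0 ^ (k + 4)) = 0 := by
    intro k
    have h1 : ((k : ℝ) + 2) ≠ 0 := by positivity
    have h2 : ((k : ℝ) + 4) ≠ 0 := by positivity
    -- Starting from `Z = x^(k+4)`, the relations `Z' = x Y` and `Y' = x C₀` determine `Y` and `C₀`.
    have h := hZ (C (((k : ℝ) + 2) * (k + 4)) * X 0 ^ k) _ _ (C ((k : ℝ) + 4) * X 0 ^ (k + 2))
      (X 0 ^ (k + 4)) ?_ ?_ ?_ ?_ ?_ rfl rfl ?_ ?_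
    · exact h
    all_goals simp [pderiv_X, Derivation.leibniz_pow]
    all_goals simp only [c2, c4]
    all_goals ring
  have hall : ∀ l k : ℕ, m (X 1 ^ l * X 0 ^ (k + 4)) = 0 := by
    intro l
    induction l using Nat.strong_induction_on with
    | _ l ih =>
      intro k
      match l, ih with
      | 0, _ => simpa using hx4 k
      | 1, _ =>
        have h1 := hy (X 0 ^ (k + 4))
        have e : pderiv 1 (circlePoly * X 0 ^ (k + 4)) =
            (-2 : ℝ) • (X 1 ^ 1 * X 0 ^ (k + 4) : MvPolynomial (Fin 2) ℝ) := by
          rw [smul_eq_C_mul]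
          simp [circlePoly, pderiv_X, Derivation.leibniz_pow, c2]
          ring
        rw [e, map_smul, smul_eq_mul] at h1
        simpa using h1
      | l + 2, ih =>
        -- Expanding this derivative expresses the moment with `y^(l+2)` through moments with `y^l`.
        have h1 := hy (X 1 ^ (l + 1) * X 0 ^ (k + 4))
        have e : pderiv 1 (circlePoly * (X 1 ^ (l + 1) * X 0 ^ (k + 4))) =
            ((l : ℝ) + 1) • (X 1 ^ l * X 0 ^ (k + 4) : MvPolynomial (Fin 2) ℝ)
            - ((l : ℝ) + 1) • (X 1 ^ l * X 0 ^ (k + 2 + 4) : MvPolynomial (Fin 2) ℝ)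
            - ((l : ℝ) + 3) • (X 1 ^ (l + 2) * X 0 ^ (k + 4) : MvPolynomial (Fin 2) ℝ) := by
          simp only [smul_eq_C_mul]
          simp [circlePoly, pderiv_X, Derivation.leibniz_pow, c3]
          ring
        rw [e, map_sub, map_sub, map_smul, map_smul, map_smul, ih l (by omega), ih l (by omega)]
          at h1
        have h2 : ((l : ℝ) + 3) ≠ 0 := by positivity
        simpa [h2] using h1
  refine eq_zero_of_forall_inner_mul fun p => ?_
  rw [← hm]
  have hlin : m ∘ₗ LinearMap.mulLeft ℝ (X 0 ^ 4) = 0 := by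
    refine (basisMonomials (Fin 2) ℝ).ext fun σ => ?_
    have h1 := hall (σ 1) (σ 0)
    have e : X 0 ^ 4 * monomial σ (1 : ℝ) = X 1 ^ σ 1 * X 0 ^ (σ 0 + 4) := by
      rw [monomial_eq, Finsupp.prod_fintype _ _ (fun i => pow_zero _)]
      simp [Fin.prod_univ_two]
      ring
    simpa [e] using h1
  exact DFunLike.congr_fun hlin p

end OneVariableEigenfunctions

/-! ### Monotonicity in `τ` and its strictness. -/

section Comparison

theorem isLeast_diskLevels {τ : ℝ} (hτ : 1 ≤ τ) {j : ℕ} (hj : 1 ≤ j) :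
    IsLeast (diskLevels τ j) (sInf (diskLevels τ j)) :=
  isLeast_formLevels (isGraphInner τ) (hasDivergentRayleigh hτ) hj
    (exists_linearIndependent_graphFst (by positivity) j)

theorem finrank_polySpace_zero_le : Module.finrank ℝ (polySpace 0) ≤ 1 := by
  have h : polySpace 0 ≤ Submodule.span ℝ {polyL2 1} := by
    rintro _ ⟨p, hp, rfl⟩
    have hp' := (MvPolynomial.mem_restrictTotalDegree _ _ _).1 hp
    rw [Nat.le_zero, MvPolynomial.totalDegree_eq_zero_iff_eq_C] at hp'
    rw [hp', ← mul_one (MvPolynomial.C _), ← MvPolynomial.smul_eq_C_mul, map_smul]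
    exact Submodule.smul_mem _ _ (Submodule.mem_span_singleton_self _)
  refine (Submodule.finrank_mono h).trans ((finrank_span_le_card _).trans ?_)
  simp

/-- Two independent eigenfunctions have a nonzero combination orthogonal to constants, where
Poincaré with `N = 0` gives `3 ≤ t`. This is where `j ≥ 2` is needed. -/
theorem diskLevels_one_pos {j : ℕ} (hj : 2 ≤ j) {t : ℝ} (ht : t ∈ diskLevels 1 j) : 0 < t := by
  obtain ⟨u, hu, h⟩ := ht
  choose κ hκ h0 w hw he using h
  obtain ⟨c, hc, hperp⟩ := exists_combination_mem_orthogonal u (polySpace 0)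
    (finrank_polySpace_zero_le.trans_lt hj)
  have e : graphFst 1 (∑ i, c i • w i) = ∑ i, c i • u i := by simp [hw]
  have h1 := norm_sq_sum_le_of_eigen Finset.univ κ w hκ he c
  have h2 := poincare_unitDisk 0 (isWeakGradient_graph (∑ i, c i • w i)) (by rwa [e])
  rw [inv_one, stretch_one] at h2
  have h3 : graphFst 1 (∑ i, c i • w i) ≠ 0 := fun h => hc <| by
    rw [e] at h
    exact funext (Fintype.linearIndependent_iff.1 hu c h)
  have h4 : 0 < ‖graphFst 1 (∑ i, c i • w i)‖ ^ 2 := by positivity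
  push_cast at h2
  by_contra! hneg
  nlinarith

/-- The two squared norms differ by the integral of `(1 - τ⁻²) G₁²`, with `G₁` the second coordinate
of `G`. -/
theorem snd_eq_zero_of_norm_le_stretch {τ : ℝ} (hτ : 1 < τ) {G : L2Field unitDisk}
    (h : ‖G‖ ^ 2 ≤ ‖stretch τ⁻¹ G‖ ^ 2) :
    ∀ᵐ x ∂(volume.restrict unitDisk), stretch τ⁻¹ G x 1 = 0 := by
  have hτ2 : 0 < 1 - (τ⁻¹) ^ 2 := by
    have : (τ⁻¹) ^ 2 < 1 := pow_lt_one₀ (by positivity) (inv_lt_one_of_one_lt₀ hτ) two_ne_zero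
    linarith
  have hi := (L2.integrable_inner (𝕜 := ℝ) G G).sub
    (L2.integrable_inner (𝕜 := ℝ) (stretch τ⁻¹ G) (stretch τ⁻¹ G))
  have hpt : ∀ᵐ x ∂(volume.restrict unitDisk), inner ℝ (G x) (G x)
      - inner ℝ (stretch τ⁻¹ G x) (stretch τ⁻¹ G x) = (1 - (τ⁻¹) ^ 2) * (G x 1) ^ 2 := by
    filter_upwards [coeFn_stretch τ⁻¹ G] with x hx
    rw [hx]
    simp only [PiLp.inner_apply, Fin.sum_univ_two, diagMap_apply_zero, diagMap_apply_one,
      RCLike.inner_apply, conj_trivial]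
    ring
  have h0 : ∫ x in unitDisk, (inner ℝ (G x) (G x)
      - inner ℝ (stretch τ⁻¹ G x) (stretch τ⁻¹ G x)) = 0 := by
    refine le_antisymm ?_ (integral_nonneg_of_ae ?_)
    · rw [integral_sub (L2.integrable_inner (𝕜 := ℝ) _ _) (L2.integrable_inner (𝕜 := ℝ) _ _),
        ← L2.inner_def, ← L2.inner_def, real_inner_self_eq_norm_sq, real_inner_self_eq_norm_sq]
      linarith
    · filter_upwards [hpt] with x hx
      rw [hx, Pi.zero_apply]
      positivity
  have h0' := (integral_eq_zero_iff_of_nonneg_ae (by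
    filter_upwards [hpt] with x hx
    rw [Pi.sub_apply, hx, Pi.zero_apply]
    positivity) hi).1 h0
  filter_upwards [h0', hpt, coeFn_stretch τ⁻¹ G] with x h1 h2 h3
  rw [Pi.sub_apply, h2, Pi.zero_apply] at h1
  have h4 : (G x 1) ^ 2 = 0 := (mul_eq_zero.1 h1).resolve_left hτ2.ne'
  rw [h3, diagMap_apply_one, sq_eq_zero_iff.1 h4, mul_zero]

/-- Reuses the eigenfunctions of the `τ`-form as trial functions for the disk, keeping track of both
energies. -/
theorem exists_family_of_mem_diskLevels {τ : ℝ} {j : ℕ} {t : ℝ}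
    (ht : t ∈ diskLevels τ j) :
    ∃ (w : Fin j → stretchedGraph τ) (w' : Fin j → stretchedGraph 1),
      LinearIndependent ℝ (fun i => graphFst 1 (w' i)) ∧
      (∀ c : Fin j → ℝ, graphFst 1 (∑ i, c i • w' i) = graphFst τ (∑ i, c i • w i)) ∧
      (∀ c : Fin j → ℝ, graphSnd 1 (∑ i, c i • w' i)
        = stretch τ⁻¹ (graphSnd τ (∑ i, c i • w i))) ∧
      ∀ c : Fin j → ℝ, ‖graphSnd τ (∑ i, c i • w i)‖ ^ 2
        ≤ t * ‖graphFst τ (∑ i, c i • w i)‖ ^ 2 := by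
  obtain ⟨u, hu, h⟩ := ht
  choose κ hκ h0 w hw he using h
  let w' : Fin j → stretchedGraph 1 := fun i =>
    graphMk one_ne_zero (isWeakGradient_graph (w i))
  have h1 : ∀ i, graphFst 1 (w' i) = graphFst τ (w i) := fun i =>
    graphFst_graphMk one_ne_zero (isWeakGradient_graph (w i))
  have h2 : ∀ i, graphSnd 1 (w' i) = stretch τ⁻¹ (graphSnd τ (w i)) := fun i =>
    (graphSnd_graphMk one_ne_zero (isWeakGradient_graph (w i))).trans (stretch_one _)
  refine ⟨w, w', ?_, fun c => ?_, fun c => ?_,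
    norm_sq_sum_le_of_eigen Finset.univ κ w hκ he⟩
  · simp only [h1, hw]
    exact hu
  · simp only [map_sum, map_smul, h1]
  · simp only [map_sum, map_smul, h2]

theorem sInf_diskLevels_one_le {τ : ℝ} (hτ : 1 ≤ τ) {j : ℕ} (hj : 1 ≤ j) :
    sInf (diskLevels 1 j) ≤ sInf (diskLevels τ j) := by
  obtain ⟨w, w', hli, h1, h2, hb⟩ := exists_family_of_mem_diskLevels (isLeast_diskLevels hτ hj).1
  refine (isLeast_diskLevels le_rfl hj).2 (mem_formLevels_of_forall_le (isGraphInner 1)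
    (hasDivergentRayleigh le_rfl) w' hli fun c => ?_)
  rw [h1, h2]
  exact (pow_le_pow_left₀ (norm_nonneg _) (norm_le_norm_stretch hτ _) 2).trans (hb c)

theorem sInf_diskLevels_one_lt {τ : ℝ} (hτ : 1 < τ) {j : ℕ} (hj : 2 ≤ j) :
    sInf (diskLevels 1 j) < sInf (diskLevels τ j) := by
  have hj1 : 1 ≤ j := by omega
  refine (sInf_diskLevels_one_le hτ.le hj1).lt_of_ne fun heq => ?_
  obtain ⟨w, w', hli, h1, h2, hb⟩ :=
    exists_family_of_mem_diskLevels (isLeast_diskLevels hτ.le hj1).1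
  rw [← heq] at hb
  have hleast := isLeast_diskLevels (le_refl (1 : ℝ)) hj1
  set t := sInf (diskLevels 1 j)
  obtain ⟨c, hc, he⟩ := exists_eigen_of_forall_le (isGraphInner 1) (hasDivergentRayleigh le_rfl)
    hj1 hleast.2 w' hli fun c => by
      rw [h1, h2]
      exact (pow_le_pow_left₀ (norm_nonneg _) (norm_le_norm_stretch hτ.le _) 2).trans (hb c)
  refine hc (eq_zero_of_eigen_of_snd_eq_zero (diskLevels_one_pos hj hleast.1).ne'
    (G := graphSnd 1 (∑ i, c i • w' i)) ?_ ?_ ?_)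
  · simpa [stretch_one] using isWeakGradient_graph (∑ i, c i • w' i)
  · rw [h2]
    refine snd_eq_zero_of_norm_le_stretch hτ ((hb c).trans_eq ?_)
    rw [← h2, ← real_inner_self_eq_norm_sq (graphSnd 1 _), he, real_inner_self_eq_norm_sq, h1]
  · intro v H hH
    simpa [stretch_one] using he (graphMk one_ne_zero hH)

end Comparison

/-! ### Diameter and normal form of an ellipse. -/

section Geometry

variable {c : Plane} {e : OrthonormalBasis (Fin 2) ℝ Plane} {a b : ℝ}

theorem norm_sq_eq_inner_sq (e : OrthonormalBasis (Fin 2) ℝ Plane) (x : Plane) :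
    ‖x‖ ^ 2 = inner ℝ (e 0) x ^ 2 + inner ℝ (e 1) x ^ 2 := by
  rw [← e.repr.norm_map x, EuclideanSpace.norm_sq_eq, Fin.sum_univ_two]
  simp [OrthonormalBasis.repr_apply_apply]

theorem ellipse_eq_ball (ha : 0 < a) :
    {p : Plane | (inner ℝ (e 0) (p - c) / a) ^ 2 + (inner ℝ (e 1) (p - c) / a) ^ 2 < 1}
      = Metric.ball c a := by
  ext p
  rw [Set.mem_ofPred_eq, mem_ball_iff_norm, ← sq_lt_sq₀ (norm_nonneg _) ha.le,
    norm_sq_eq_inner_sq e, div_pow, div_pow, ← add_div, div_lt_one (by positivity)]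

theorem diam_ellipse (hb : 0 < b) (hab : b ≤ a) :
    Metric.diam {p : Plane | (inner ℝ (e 0) (p - c) / a) ^ 2 + (inner ℝ (e 1) (p - c) / b) ^ 2 < 1}
      = 2 * a := by
  have ha : 0 < a := hb.trans_le hab
  have hsub : {p : Plane | (inner ℝ (e 0) (p - c) / a) ^ 2 + (inner ℝ (e 1) (p - c) / b) ^ 2 < 1}
      ⊆ Metric.ball c a := by
    rw [← ellipse_eq_ball (e := e) ha]
    intro p hp
    rw [Set.mem_ofPred_eq] at hp ⊢
    refine lt_of_le_of_lt ?_ hp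
    simp only [div_pow]
    gcongr
  refine le_antisymm ((Metric.diam_mono hsub Metric.isBounded_ball).trans
    (Metric.diam_ball ha.le)) ?_
  by_contra! hlt
  -- The ellipse is open, so its vertices are only approached: the points `c ± s a e₀` with `s < 1`
  -- are already further apart than the supposed diameter.
  obtain ⟨s, hs, hs1⟩ := exists_between ((div_lt_one (by positivity)).2 hlt)
  have hs0 : 0 < s := (div_nonneg Metric.diam_nonneg (by positivity)).trans_lt hs
  rw [div_lt_iff₀ (by positivity)] at hs
  have e00 : inner ℝ (e 0) (e 0) = 1 := by simp
  have e10 : inner ℝ (e 1) (e 0) = 0 := e.inner_eq_zero (by decide)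
  have hmem : ∀ σ : ℝ, |σ| < 1 → c + (σ * a) • e 0 ∈
      {p : Plane | (inner ℝ (e 0) (p - c) / a) ^ 2 + (inner ℝ (e 1) (p - c) / b) ^ 2 < 1} := by
    intro σ hσ
    rw [Set.mem_ofPred_eq, add_sub_cancel_left, real_inner_smul_right, real_inner_smul_right,
      e00, e10, mul_zero, zero_div, mul_one, mul_div_cancel_right₀ _ ha.ne']
    simpa [sq_lt_one_iff_abs_lt_one] using hσ
  have hd := Metric.dist_le_diam_of_mem (Metric.isBounded_ball.subset hsub)
    (hmem s (by rwa [abs_of_pos hs0])) (hmem (-s) (by rwa [abs_neg, abs_of_pos hs0]))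
  rw [dist_add_left, dist_eq_norm, ← sub_smul, norm_smul, e.norm_eq_one, mul_one,
    Real.norm_eq_abs] at hd
  have : |s * a - -s * a| = s * (2 * a) := by
    rw [abs_of_pos (by nlinarith)]
    ring
  linarith

/-- Putting the longer semi-axis first gives both diameter `2a` and `τ ≥ 1`. -/
theorem IsEllipse.exists_normal_form {E : Set Plane} (hE : IsEllipse E) :
    ∃ (c : Plane) (e : OrthonormalBasis (Fin 2) ℝ Plane) (a b : ℝ), 0 < b ∧ b ≤ a ∧
      E = {p : Plane | (inner ℝ (e 0) (p - c) / a) ^ 2 + (inner ℝ (e 1) (p - c) / b) ^ 2 < 1} := by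
  obtain ⟨c, e, a, b, ha, hb, rfl⟩ := hE
  rcases le_total b a with h | h
  · exact ⟨c, e, a, b, hb, h, rfl⟩
  · refine ⟨c, e.reindex (Equiv.swap 0 1), b, a, ha, h, ?_⟩
    ext p
    simp [add_comm]

theorem isLeast_neumannLevels_of_eq {Ω : Set Plane} {τ : ℝ} (ha : 0 < a) {j : ℕ}
    (h : neumannLevels Ω j = {t | a ^ 2 * t ∈ diskLevels τ j}) (hτ : 1 ≤ τ) (hj : 1 ≤ j) :
    IsLeast (neumannLevels Ω j) (neumannEigenvalue Ω j) ∧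
      neumannEigenvalue Ω j * (2 * a) ^ 2 = 4 * sInf (diskLevels τ j) := by
  have h1 : IsLeast (neumannLevels Ω j) (sInf (diskLevels τ j) / a ^ 2) := by
    have hl := isLeast_diskLevels hτ hj
    rw [h]
    refine ⟨?_, fun t ht => ?_⟩
    · rw [Set.mem_ofPred_eq, mul_div_cancel₀ _ (by positivity)]
      exact hl.1
    · rw [div_le_iff₀' (by positivity)]
      exact hl.2 ht
  have h2 : neumannEigenvalue Ω j = sInf (diskLevels τ j) / a ^ 2 := h1.csInf_eq
  rw [h2]
  refine ⟨h1, ?_⟩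
  field_simp
  ring

theorem IsEllipse.neumann_summary {E : Set Plane} (hE : IsEllipse E) :
    ∃ τ : ℝ, 1 ≤ τ ∧ (τ = 1 → IsDisk E) ∧ ∀ j, 1 ≤ j →
      IsLeast (neumannLevels E j) (neumannEigenvalue E j) ∧
        neumannEigenvalue E j * Metric.diam E ^ 2 = 4 * sInf (diskLevels τ j) := by
  obtain ⟨c, e, a, b, hb, hab, rfl⟩ := hE.exists_normal_form
  have ha : 0 < a := hb.trans_le hab
  have hτ : 1 ≤ a / b := (one_le_div hb).2 hab
  refine ⟨a / b, hτ, fun h => ?_, fun j hj => ?_⟩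
  · rw [div_eq_one_iff_eq hb.ne'] at h
    subst h
    exact ⟨c, a, ha, ellipse_eq_ball ha⟩
  · rw [diam_ellipse hb hab]
    exact isLeast_neumannLevels_of_eq ha (neumannLevels_ellipse ha hb j) hτ hj

theorem IsDisk.neumann_summary {B : Set Plane} (hB : IsDisk B) {j : ℕ} (hj : 1 ≤ j) :
    IsLeast (neumannLevels B j) (neumannEigenvalue B j) ∧
      neumannEigenvalue B j * Metric.diam B ^ 2 = 4 * sInf (diskLevels 1 j) := by
  obtain ⟨c, r, hr, rfl⟩ := hB
  have h := neumannLevels_ellipse (c := c) (e := EuclideanSpace.basisFun (Fin 2) ℝ) hr hr j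
  have hd := diam_ellipse (c := c) (e := EuclideanSpace.basisFun (Fin 2) ℝ) hr le_rfl
  rw [ellipse_eq_ball hr, div_self hr.ne'] at h
  rw [ellipse_eq_ball hr] at hd
  rw [hd]
  exact isLeast_neumannLevels_of_eq hr h le_rfl hj

end Geometry

theorem proposition3 (E B : Set Plane) (hE : IsEllipse E) (hB : IsDisk B)
    (j : ℕ) (hj : 2 ≤ j) :
    IsLeast (neumannLevels E j) (neumannEigenvalue E j) ∧
    IsLeast (neumannLevels B j) (neumannEigenvalue B j) ∧
    neumannEigenvalue B j * Metric.diam B ^ 2 ≤ neumannEigenvalue E j * Metric.diam E ^ 2 ∧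
    (neumannEigenvalue E j * Metric.diam E ^ 2 = neumannEigenvalue B j * Metric.diam B ^ 2 ↔
      IsDisk E) := by
  have hj1 : 1 ≤ j := by omega
  obtain ⟨τ, hτ, hdisk, hsum⟩ := hE.neumann_summary
  obtain ⟨hEl, hEv⟩ := hsum j hj1
  obtain ⟨hBl, hBv⟩ := hB.neumann_summary hj1
  refine ⟨hEl, hBl, ?_, fun h => ?_, fun h => ?_⟩
  · rw [hEv, hBv]
    have := sInf_diskLevels_one_le hτ hj1
    gcongr
  · refine hdisk (hτ.eq_of_not_lt' fun hlt => ?_)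
    have := sInf_diskLevels_one_lt hlt hj
    rw [hEv, hBv] at h
    linarith
  · rw [(h.neumann_summary hj1).2, hBv]
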